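/- Let $a=a(x,t)$ and $\psi=\psi(x,t)$ be real-valued Borel functions on $\mathbb{R}\times[0,\infty)$ such that, for every $t\ge 0$, the functions $a(\cdot,t)$ and $\psi(\cdot,t)$ have locally bounded variation on $\mathbb{R}$ and are right-continuous. Assume that $a$ is bounded on compact subsets of $\mathbb{R}\times[0,\infty)$ and that there is a constant $E$ such that, for every $t>0$, $$\partial_x a(\cdot,t)\le \frac{E}{t}$$ in the sense of distributions on $\mathbb{R}$. Let $\psi$ be a solution of $$\partial_t\psi+\partial_x(a\psi)=0,$$ that is, the equation holds in the sense of distributions on $\mathbb{R}\times(0,\infty)$, and $t\mapsto\psi(\cdot,t)$ is continuous from $[0,\infty)$ to $L^1_{\mathrm{loc}}(\mathbb{R})$ (so that $\psi(\cdot,0)$ is the initial value). A forward generalized characteristic leaving from $(x_0,0)$ is a locally absolutely continuous curve $y:[0,\infty)\to\mathbb{R}$ with $y(0)=x_0$ and $a(y(t)+,t)\le y'(t)\le a(y(t)-,t)$ for almost every $t>0$, where $a(x\pm,t)$ are the right and left limits of $a(\cdot,t)$ at $x$. Let $\xi_0\le\zeta_0$ and suppose that $\psi(x,0)\ge 0$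 for all $x\in[\xi_0,\zeta_0]$. Let $\xi$ be any forward generalized characteristic leaving from $(\xi_0,0)$ and $\zeta$ any forward generalized characteristic leaving from $(\zeta_0,0)$. Then, for all $t\ge 0$, $$\psi(x,t)\ge 0\qquad\text{for all } x\in(\xi(t),\zeta(t)).$$ -/

import Mathlib

open MeasureTheory Set Filter Topology
open scoped ContDiff

namespace TransportBV

/-- A function `u = u(x,t)` on `ℝ × [0,∞)` (written `u x t`; the values for `t < 0` are
irrelevant) which at every time has locally bounded variation in `x`, and which is normalized to
be defined everywhere as a right-continuous function of `x`. -/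
structure IsNormalizedBV (u : ℝ → ℝ → ℝ) : Prop where
  measurable : Measurable (fun p : ℝ × ℝ => u p.1 p.2)
  locallyBoundedVariation : ∀ t : ℝ, 0 ≤ t → LocallyBoundedVariationOn (fun x => u x t) univ
  rightContinuous : ∀ t : ℝ, 0 ≤ t → ∀ x : ℝ, ContinuousWithinAt (fun x => u x t) (Ici x) x

/-- `u` is bounded on every rectangle `[-R,R] × [0,T]`. -/
def IsLocallyBounded (u : ℝ → ℝ → ℝ) : Prop :=
  ∀ R T : ℝ, ∃ C : ℝ, ∀ x t : ℝ, |x| ≤ R → 0 ≤ t → t ≤ T → |u x t| ≤ C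

/-- The one-sided bound `∂ₓ a ≤ E / t`: at every time `t > 0` the distributional derivative of
`a(·,t)` is bounded above by the constant `E / t`. -/
def OleinikBound (a : ℝ → ℝ → ℝ) (E : ℝ) : Prop :=
  ∀ t : ℝ, 0 < t → ∀ φ : ℝ → ℝ, ContDiff ℝ ∞ φ → HasCompactSupport φ → (∀ x, 0 ≤ φ x) →
    -∫ x, a x t * deriv φ x ≤ E / t * ∫ x, φ x

/-- `∂ₜ ψ + ∂ₓ (a ψ) = 0` in the sense of distributions on `ℝ × (0,∞)`. -/
def WeakTransportEq (a ψ : ℝ → ℝ → ℝ) : Prop :=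
  ∀ φ : ℝ × ℝ → ℝ, ContDiff ℝ ∞ φ → HasCompactSupport φ → tsupport φ ⊆ {p | 0 < p.2} →
    ∫ p : ℝ × ℝ,
      (ψ p.1 p.2 * fderiv ℝ φ p (0, 1) + a p.1 p.2 * ψ p.1 p.2 * fderiv ℝ φ p (1, 0)) = 0

/-- `ψ` is a solution, of bounded variation at each time, of `∂ₜ ψ + ∂ₓ (a ψ) = 0`: the equation
holds in the sense of distributions for `t > 0`, and `t ↦ ψ(·,t)` is continuous from `[0,∞)` to
`L¹_loc(ℝ)`. In particular `ψ(·,0)` is the initial value of `ψ`. -/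
structure IsBVSolution (a ψ : ℝ → ℝ → ℝ) : Prop where
  normalizedBV : IsNormalizedBV ψ
  continuousInTime : ∀ R t₀ : ℝ, 0 ≤ R → 0 ≤ t₀ →
    Tendsto (fun t => ∫ x in (-R)..R, |ψ x t - ψ x t₀|) (𝓝[Ici 0] t₀) (𝓝 0)
  equation : WeakTransportEq a ψ

/-- `y : [0,∞) → ℝ` is a forward generalized characteristic of `a` leaving from `(x₀, 0)`: it is
absolutely continuous on bounded intervals, `y(0) = x₀`, and
`a₊(y(t),t) ≤ y'(t) ≤ a₋(y(t),t)` for almost every `t > 0`, where `a₊` and `a₋` are the right and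
left traces in `x`. (An absolutely continuous function is differentiable almost everywhere.) -/
structure IsForwardGenChar (a : ℝ → ℝ → ℝ) (x₀ : ℝ) (y : ℝ → ℝ) : Prop where
  absolutelyContinuous : ∀ T : ℝ, 0 < T → AbsolutelyContinuousOnInterval y 0 T
  initial : y 0 = x₀
  speed : ∀ᵐ t : ℝ, 0 < t →
    Function.rightLim (fun x => a x t) (y t) ≤ deriv y t ∧
      deriv y t ≤ Function.leftLim (fun x => a x t) (y t)

end TransportBV

/-! Fix `t > 0`. By right-continuity it is enough that `∫ ψ(·,t) ≥ 0` over every interval `[x₁, x₂]`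
strictly between `ξ t` and `ζ t`. Formally, carry such an interval backwards along the flow of `a`:
the mass between two trajectories is conserved, trajectories starting between `ξ` and `ζ` stay
between them, and near time `0` that mass is almost nonnegative. The speed `a` may jump, so this is
carried out for a smoothed speed `b = avg ρ a`, with a kernel `ρ` supported in `[0, ε]`. Kernels
looking to the right suit right-continuous functions: the averages converge at every point of
right-continuity.

The one-sided bound on `∂ₓ a` survives averaging, with constant `K = max E 0 / s` on `[s, t]`. It
enters twice through Gronwall. Trajectories of `b` cannot leave the region between `ξ` and `ζ` if at
time `t` they are farther than `ε exp(K(t-s))` from its boundary (`IsForwardGenChar.lt_trajectory`,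
`IsForwardGenChar.trajectory_lt`). Moreover the backward flow shrinks distances by at most the
factor `Λ = exp(K(t-s))` (`IsTrajectory.sub_le_mul_exp`), so it sends Lebesgue measure to a measure
of density at most `Λ`.

The averaged density `d = avg ρ ψ` satisfies `∂ₜ d + ∂ₓ(b d) = ∂ₓ r` with the commutator `r = b d -
avg ρ (a ψ)`. Hence the mass of `d` between two trajectories of `b` changes only by the integrals of
`r` along them (`integral_avg_localDensity_trajectory`). After localization in space, `r → 0` in
`L¹` of space-time as `ε → 0` (`tendsto_lintegral_commutator`). That says nothing about one given
trajectory, but by the density bound and Chebyshev, every interval of end points of length `δ`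
contains one along which the integral of `r` is small (`exists_small_commutator`). Moving `x₁` and
`x₂` by at most `δ` onto such end points costs little, and the mass at time `t` is then almost the
mass at time `s`.

The order of the choices matters: `K` blows up as `s → 0`, so `s` is fixed first, using the `L¹`
continuity of `ψ` at time `0`, and only then is `ε` made small. -/

namespace TransportBV

/-! ### Averages over points to the right -/

/-- A smooth probability density supported in `[0, ε]`. -/
structure IsRightKernel (ρ : ℝ → ℝ) (ε : ℝ) : Prop where
  contDiff : ContDiff ℝ ∞ ρ
  nonneg : ∀ z, 0 ≤ ρ z
  eq_zero : ∀ z, z ∉ Icc 0 ε → ρ z = 0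
  integral_eq_one : ∫ z, ρ z = 1

/-- The average of `f` over the points to the right of `x`, weighted by `ρ`. -/
noncomputable def avg (ρ f : ℝ → ℝ) (x : ℝ) : ℝ := ∫ z, ρ z * f (x + z)

/-- The indicator function of `[x, y]`, smoothed by `ρ`. -/
noncomputable def window (ρ : ℝ → ℝ) (x y z : ℝ) : ℝ := ∫ w in x..y, ρ (z - w)

theorem exists_isRightKernel {ε : ℝ} (hε : 0 < ε) : ∃ ρ, IsRightKernel ρ ε := by
  let f : ContDiffBump (ε / 2) := ⟨ε / 4, ε / 2, by positivity, by linarith⟩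
  refine ⟨f.normed volume, f.contDiff_normed, f.nonneg_normed, fun z hz => ?_, f.integral_normed⟩
  have h : z ∉ Function.support (f.normed volume) := by
    rw [f.support_normed_eq, Real.ball_eq_Ioo]
    intro h
    apply hz
    have h1 : f.rOut = ε / 2 := rfl
    rw [h1] at h
    exact ⟨by linarith [h.1], by linarith [h.2]⟩
  simpa using h

namespace IsRightKernel

variable {ρ : ℝ → ℝ} {ε : ℝ}

theorem continuous (h : IsRightKernel ρ ε) : Continuous ρ := h.contDiff.continuous

theorem hasCompactSupport (h : IsRightKernel ρ ε) : HasCompactSupport ρ :=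
  HasCompactSupport.intro isCompact_Icc (fun z hz => h.eq_zero z hz)

theorem integrable (h : IsRightKernel ρ ε) : Integrable ρ :=
  h.continuous.integrable_of_hasCompactSupport h.hasCompactSupport

theorem nonneg_width (h : IsRightKernel ρ ε) : 0 ≤ ε := by
  by_contra hε
  have : ρ = 0 := funext fun z => h.eq_zero z (by simp; intro _; linarith)
  simpa [this] using h.integral_eq_one

theorem integrable_mul_comp_add (h : IsRightKernel ρ ε) {f : ℝ → ℝ}
    (hf : LocallyIntegrable f) (x : ℝ) : Integrable (fun z => ρ z * f (x + z)) := by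
  have h1 : Integrable (fun y => ρ (y - x) * f y) := by
    have := hf.integrable_smul_left_of_hasCompactSupport (g := fun y => ρ (y - x))
      (h.continuous.comp (by fun_prop))
      (h.hasCompactSupport.comp_homeomorph (Homeomorph.subRight x))
    simpa using this
  have := h1.comp_add_left x
  simpa using this

theorem avg_eq (ρ f : ℝ → ℝ) (x : ℝ) : avg ρ f x = ∫ y, ρ (y - x) * f y := by
  rw [avg, ← integral_add_left_eq_self (fun y => ρ (y - x) * f y) x]
  simp

theorem avg_const (h : IsRightKernel ρ ε) (c x : ℝ) : avg ρ (fun _ => c) x = c := by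
  simp [avg, integral_mul_const, h.integral_eq_one]

theorem avg_mono (h : IsRightKernel ρ ε) {f g : ℝ → ℝ} {x y : ℝ}
    (hf : LocallyIntegrable f) (hg : LocallyIntegrable g)
    (hfg : ∀ z ∈ Icc 0 ε, f (x + z) ≤ g (y + z)) : avg ρ f x ≤ avg ρ g y := by
  refine integral_mono (h.integrable_mul_comp_add hf x) (h.integrable_mul_comp_add hg y) fun z => ?_
  by_cases hz : z ∈ Icc 0 ε
  · exact mul_le_mul_of_nonneg_left (hfg z hz) (h.nonneg z)
  · simp [h.eq_zero z hz]

theorem avg_le (h : IsRightKernel ρ ε) {f : ℝ → ℝ} {x c : ℝ} (hf : LocallyIntegrable f)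
    (hfc : ∀ z ∈ Icc 0 ε, f (x + z) ≤ c) : avg ρ f x ≤ c := by
  rw [← h.avg_const c x]
  exact h.avg_mono hf (locallyIntegrable_const c) hfc

theorem le_avg (h : IsRightKernel ρ ε) {f : ℝ → ℝ} {x c : ℝ} (hf : LocallyIntegrable f)
    (hfc : ∀ z ∈ Icc 0 ε, c ≤ f (x + z)) : c ≤ avg ρ f x := by
  rw [← h.avg_const c x]
  exact h.avg_mono (locallyIntegrable_const c) hf hfc

theorem abs_avg_le (h : IsRightKernel ρ ε) {f : ℝ → ℝ} {x c : ℝ} (hf : LocallyIntegrable f)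
    (hfc : ∀ z ∈ Icc 0 ε, |f (x + z)| ≤ c) : |avg ρ f x| ≤ c :=
  abs_le.2 ⟨h.le_avg hf fun z hz => (abs_le.1 (hfc z hz)).1,
    h.avg_le hf fun z hz => (abs_le.1 (hfc z hz)).2⟩

theorem avg_sub (h : IsRightKernel ρ ε) {f g : ℝ → ℝ} (hf : LocallyIntegrable f)
    (hg : LocallyIntegrable g) (x : ℝ) :
    avg ρ (fun y => f y - g y) x = avg ρ f x - avg ρ g x := by
  simp only [avg, mul_sub]
  exact integral_sub (h.integrable_mul_comp_add hf x) (h.integrable_mul_comp_add hg x)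

theorem abs_avg_le_avg_abs (h : IsRightKernel ρ ε) (f : ℝ → ℝ) (x : ℝ) :
    |avg ρ f x| ≤ avg ρ (fun y => |f y|) x := by
  refine (abs_integral_le_integral_abs).trans_eq ?_
  simp [avg, abs_mul, abs_of_nonneg (h.nonneg _)]

theorem measurable_avg (h : IsRightKernel ρ ε) {α : Type*} [MeasurableSpace α] {f : α → ℝ → ℝ}
    (hf : Measurable (Function.uncurry f)) :
    Measurable (fun q : α × ℝ => avg ρ (f q.1) q.2) := by
  have : StronglyMeasurable (fun r : (α × ℝ) × ℝ => ρ r.2 * f r.1.1 (r.1.2 + r.2)) := by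
    apply Measurable.stronglyMeasurable
    exact (h.continuous.measurable.comp measurable_snd).mul
      (hf.comp (measurable_fst.fst.prodMk (measurable_fst.snd.add measurable_snd)))
  exact this.integral_prod_right.measurable

theorem exists_lipschitz (h : IsRightKernel ρ ε) : ∃ L : ℝ, 0 ≤ L ∧ ∀ x y, |ρ x - ρ y| ≤ L * |x - y| := by
  obtain ⟨L, hL⟩ := ContDiff.lipschitzWith_of_hasCompactSupport h.hasCompactSupport
    h.contDiff (by simp)
  exact ⟨L, L.2, fun x y => by simpa [Real.dist_eq] using hL.dist_le_mul x y⟩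

theorem abs_avg_sub_le (h : IsRightKernel ρ ε) {L : ℝ} (hL : ∀ x y, |ρ x - ρ y| ≤ L * |x - y|)
    {f : ℝ → ℝ} (hf : LocallyIntegrable f) {c : ℝ} (x y : ℝ)
    (hfi : Integrable f) (hc : ∫ z, |f z| ≤ c) (hL0 : 0 ≤ L) :
    |avg ρ f x - avg ρ f y| ≤ L * c * |x - y| := by
  have hi : ∀ x, Integrable (fun z => ρ (z - x) * f z) := fun x => by
    have := (h.integrable_mul_comp_add hf x).comp_sub_right x
    simpa using this
  rw [avg_eq, avg_eq, ← integral_sub (hi x) (hi y)]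
  calc |∫ z, (ρ (z - x) * f z - ρ (z - y) * f z)| ≤ ∫ z, L * |x - y| * |f z| := by
        rw [← Real.norm_eq_abs]
        refine norm_integral_le_of_norm_le (hfi.abs.const_mul _) (Eventually.of_forall fun z => ?_)
        rw [Real.norm_eq_abs, ← sub_mul, abs_mul]
        refine mul_le_mul_of_nonneg_right ((hL _ _).trans_eq ?_) (abs_nonneg _)
        rw [abs_sub_comm x y]; congr 2; ring
    _ = L * |x - y| * ∫ z, |f z| := integral_const_mul _ _
    _ ≤ L * |x - y| * c := by gcongr
    _ = L * c * |x - y| := by ring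

/-- The kernels see only `[x, x + ε n]`, so right-continuity at the single point `x` suffices; no
Lebesgue point argument is needed. -/
theorem tendsto_avg {ρ : ℕ → ℝ → ℝ} {ε : ℕ → ℝ} (h : ∀ n, IsRightKernel (ρ n) (ε n))
    (hε : Tendsto ε atTop (𝓝 0)) {f : ℝ → ℝ} (hf : LocallyIntegrable f) {x : ℝ}
    (hx : ContinuousWithinAt f (Ici x) x) :
    Tendsto (fun n => avg (ρ n) f x) atTop (𝓝 (f x)) := by
  rw [Metric.tendsto_atTop]
  intro η hη
  obtain ⟨δ, hδ, H⟩ := Metric.continuousWithinAt_iff.1 hx (η / 2) (by positivity)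
  obtain ⟨N, hN⟩ := (hε.eventually (gt_mem_nhds hδ)).exists_forall_of_atTop
  refine ⟨N, fun n hn => ?_⟩
  rw [Real.dist_eq, ← (h n).avg_const (f x) x, ← (h n).avg_sub hf (locallyIntegrable_const _)]
  refine lt_of_le_of_lt ((h n).abs_avg_le (c := η / 2)
    (hf.sub (locallyIntegrable_const _)) fun z hz => ?_) (by linarith)
  have := H (x := x + z) (by simpa using hz.1) (by
    rw [Real.dist_eq]; simp only [add_sub_cancel_left]
    rw [abs_of_nonneg hz.1]; linarith [hz.2, hN n hn])
  rw [Real.dist_eq] at this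
  exact this.le

/-- The shear `(z, x) ↦ (z, x + z)` preserves Lebesgue measure, and Fubini does the rest.
Preservation of the integral makes `L¹` bounds independent of the kernel. -/
theorem integrable_avg (h : IsRightKernel ρ ε) {f : ℝ → ℝ} (hf : Integrable f) :
    Integrable (avg ρ f) ∧ ∫ x, avg ρ f x = ∫ x, f x := by
  have h1 : Integrable (fun q : ℝ × ℝ => ρ q.1 * f q.2) (volume.prod volume) :=
    h.integrable.mul_prod hf
  have h2 : Integrable (fun q : ℝ × ℝ => ρ q.1 * f (q.2 + q.1)) (volume.prod volume) := by
    have hmp : MeasurePreserving (fun q : ℝ × ℝ => (q.1, q.2 + q.1)) (volume.prod volume)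
        (volume.prod volume) :=
      (MeasurePreserving.id volume).skew_product (g := fun a b : ℝ => b + a)
        (by fun_prop) (Eventually.of_forall fun a => (measurePreserving_add_right volume a).map_eq)
    exact hmp.integrable_comp_of_integrable h1
  refine ⟨h2.integral_prod_right, ?_⟩
  have := integral_integral_swap (f := fun z x => ρ z * f (x + z)) h2
  simp only [avg]
  rw [← this]
  simp only [integral_const_mul, integral_add_right_eq_self f]
  rw [integral_mul_const, h.integral_eq_one, one_mul]

end IsRightKernel
end TransportBV

/-! ### Smoothed indicators as test functions -/

namespace TransportBV
namespace IsRightKernel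

variable {ρ : ℝ → ℝ} {ε : ℝ}

theorem window_eq (h : IsRightKernel ρ ε) (x y z : ℝ) :
    window ρ x y z = (∫ w in (0 : ℝ)..(z - x), ρ w) - ∫ w in (0 : ℝ)..(z - y), ρ w := by
  rw [window, intervalIntegral.integral_comp_sub_left,
    intervalIntegral.integral_interval_sub_left] <;>
  exact h.continuous.intervalIntegrable _ _

/-- Since the derivative is a difference of two translated kernels, integrating a function against
it gives the difference of its averages at the two end points. -/
theorem hasDerivAt_window (h : IsRightKernel ρ ε) (x y z : ℝ) :
    HasDerivAt (window ρ x y) (ρ (z - x) - ρ (z - y)) z := by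
  have key : ∀ u, HasDerivAt (fun z => ∫ w in (0 : ℝ)..(z - u), ρ w) (ρ (z - u)) z := fun u => by
    have := (h.continuous.integral_hasStrictDerivAt 0 (z - u)).hasDerivAt
    simpa [Function.comp_def] using this.comp z ((hasDerivAt_id z).sub_const u)
  exact ((key x).sub (key y)).congr_of_eventuallyEq
    (Eventually.of_forall fun z => h.window_eq x y z)

theorem deriv_window (h : IsRightKernel ρ ε) (x y : ℝ) :
    deriv (window ρ x y) = fun z => ρ (z - x) - ρ (z - y) :=
  funext fun z => (h.hasDerivAt_window x y z).deriv

theorem contDiff_window (h : IsRightKernel ρ ε) (x y : ℝ) : ContDiff ℝ ∞ (window ρ x y) := by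
  rw [contDiff_infty_iff_deriv, h.deriv_window]
  have := h.contDiff
  exact ⟨fun z => (h.hasDerivAt_window x y z).differentiableAt, by fun_prop⟩

theorem window_nonneg (h : IsRightKernel ρ ε) {x y : ℝ} (hxy : x ≤ y) (z : ℝ) :
    0 ≤ window ρ x y z :=
  intervalIntegral.integral_nonneg hxy fun w _ => h.nonneg (z - w)

theorem window_eq_zero (h : IsRightKernel ρ ε) {x y : ℝ} (hxy : x ≤ y) {z : ℝ}
    (hz : z ∉ Icc x (y + ε)) : window ρ x y z = 0 := by
  rw [window, intervalIntegral.integral_congr (g := fun _ => 0), intervalIntegral.integral_zero]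
  intro w hw
  rw [uIcc_of_le hxy] at hw
  apply h.eq_zero
  intro hz'
  exact hz ⟨by linarith [hw.1, hz'.1], by linarith [hw.2, hz'.2]⟩

theorem hasCompactSupport_window (h : IsRightKernel ρ ε) {x y : ℝ} (hxy : x ≤ y) :
    HasCompactSupport (window ρ x y) :=
  HasCompactSupport.intro isCompact_Icc (fun _ hz => h.window_eq_zero hxy hz)

theorem window_le_one (h : IsRightKernel ρ ε) {x y : ℝ} (hxy : x ≤ y) (z : ℝ) :
    window ρ x y z ≤ 1 := by
  rw [window, intervalIntegral.integral_comp_sub_left, intervalIntegral.integral_of_le (by linarith),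
    ← h.integral_eq_one]
  exact setIntegral_le_integral h.integrable (Eventually.of_forall h.nonneg)

theorem window_eq_one (h : IsRightKernel ρ ε) {x y z : ℝ} (hzx : x + ε < z) (hzy : z ≤ y) :
    window ρ x y z = 1 := by
  have h0 := h.nonneg_width
  rw [window, intervalIntegral.integral_comp_sub_left, intervalIntegral.integral_of_le (by linarith),
    ← h.integral_eq_one, ← integral_Icc_eq_integral_Ioc]
  refine setIntegral_eq_integral_of_forall_compl_eq_zero fun w hw => h.eq_zero w fun hw' => hw ?_
  exact ⟨by linarith [hw'.1], by linarith [hw'.2]⟩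

/-- Fubini. Together with the formula for the derivative, it turns the equation tested with a window
into a balance between averaged mass and averaged fluxes at the ends. -/
theorem integral_mul_window (h : IsRightKernel ρ ε) {f : ℝ → ℝ} (hf : LocallyIntegrable f)
    {x y : ℝ} (hxy : x ≤ y) :
    ∫ z, f z * window ρ x y z = ∫ w in x..y, avg ρ f w := by
  set g : ℝ → ℝ := (Icc x (y + ε)).indicator f with hg
  have hgi : Integrable g :=
    (hf.integrableOn_isCompact isCompact_Icc).integrable_indicator measurableSet_Icc
  have e1 : ∀ z, f z * window ρ x y z = g z * window ρ x y z := fun z => by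
    by_cases hz : z ∈ Icc x (y + ε)
    · simp [hg, hz]
    · simp [h.window_eq_zero hxy hz]
  have e2 : ∫ w in x..y, avg ρ f w = ∫ w in x..y, ∫ z, g z * ρ (z - w) := by
    refine intervalIntegral.integral_congr fun w hw => ?_
    rw [uIcc_of_le hxy] at hw
    simp only [avg_eq]
    congr 1; ext z
    by_cases hz : z ∈ Icc x (y + ε)
    · simp [hg, hz, mul_comm]
    · rw [h.eq_zero (z - w) fun hz' => hz
        ⟨by linarith [hz'.1, hw.1], by linarith [hz'.2, hw.2]⟩]; simp
  rw [e2]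
  simp only [e1]
  have hint : Integrable (Function.uncurry fun w z => g z * ρ (z - w))
      ((volume.restrict (Ioc x y)).prod volume) := by
    have h1 : Integrable (fun q : ℝ × ℝ => (1 : ℝ) * g q.2)
        ((volume.restrict (Ioc x y)).prod volume) :=
      Integrable.mul_prod (f := fun _ => (1 : ℝ)) (integrable_const _) hgi
    obtain ⟨c, hc⟩ := h.hasCompactSupport.exists_bound_of_continuous h.continuous
    have h2 := h1.mul_bdd (c := c) (g := fun q : ℝ × ℝ => ρ (q.2 - q.1))
      (h.continuous.comp (by fun_prop)).aestronglyMeasurable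
      (Eventually.of_forall fun q => hc _)
    simpa [Function.uncurry_def] using h2
  rw [intervalIntegral.integral_of_le hxy, integral_integral_swap hint]
  simp_rw [integral_const_mul, window, intervalIntegral.integral_of_le hxy]

theorem integral_window (h : IsRightKernel ρ ε) {x y : ℝ} (hxy : x ≤ y) :
    ∫ z, window ρ x y z = y - x := by
  have := h.integral_mul_window (locallyIntegrable_const (1 : ℝ)) hxy
  simpa [h.avg_const] using this

/-- The kernels push mass to the right, so the limit indicator omits the left end point and contains
the right one. -/
theorem tendsto_window {ρ : ℕ → ℝ → ℝ} {ε : ℕ → ℝ} (h : ∀ n, IsRightKernel (ρ n) (ε n))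
    (hε : Tendsto ε atTop (𝓝 0)) {x y : ℝ} (hxy : x ≤ y) {z : ℝ} :
    Tendsto (fun n => window (ρ n) x y z) atTop (𝓝 ((Ioc x y).indicator 1 z)) := by
  refine tendsto_const_nhds.congr' ?_
  by_cases hz : z ∈ Ioc x y
  · filter_upwards [hε.eventually (gt_mem_nhds (sub_pos.2 hz.1))] with n hn
    rw [(h n).window_eq_one (by linarith) hz.2]
    simp [hz]
  · rw [indicator_of_notMem hz]
    rcases le_or_gt z x with hzx | hzx
    · refine Eventually.of_forall fun n => ?_
      have := (h n).window_nonneg hxy z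
      refine le_antisymm this (le_of_eq ?_)
      change window (ρ n) x y z = 0
      rw [window, intervalIntegral.integral_comp_sub_left, intervalIntegral.integral_of_le
        (by linarith), integral_Ioc_eq_integral_Ioo, setIntegral_eq_zero_of_forall_eq_zero]
      intro w hw
      exact (h n).eq_zero w fun hw' => by linarith [hw.2, hw'.1]
    · have hzy : y < z := by
        by_contra! hy
        exact hz ⟨hzx, hy⟩
      filter_upwards [hε.eventually (gt_mem_nhds (sub_pos.2 hzy))] with n hn
      exact ((h n).window_eq_zero hxy fun hz' => by linarith [hz'.2]).symm

end IsRightKernel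

theorem exists_isRightKernel_seq : ∃ (ρ : ℕ → ℝ → ℝ) (ε : ℕ → ℝ),
    (∀ n, IsRightKernel (ρ n) (ε n)) ∧ Tendsto ε atTop (𝓝 0) := by
  choose ρ hρ using fun n : ℕ => exists_isRightKernel (Nat.one_div_pos_of_nat (α := ℝ) (n := n))
  exact ⟨ρ, _, hρ, tendsto_one_div_add_atTop_nhds_zero_nat⟩

/-- The one-sided bound on `∂ₓ a` as a pointwise one-sided Lipschitz bound. -/
theorem OleinikBound.sub_le {a : ℝ → ℝ → ℝ} {E t : ℝ} (hE : OleinikBound a E) (ht : 0 < t)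
    (ha : LocallyIntegrable (fun x => a x t))
    (hc : ∀ x, ContinuousWithinAt (fun x => a x t) (Ici x) x) {x y : ℝ} (hxy : x ≤ y) :
    a y t - a x t ≤ E / t * (y - x) := by
  obtain ⟨ρ, ε, h, hε⟩ := exists_isRightKernel_seq
  -- Testing the distributional bound with the window on `[x, y]` gives exactly this increment on
  -- the left and the length `y - x` on the right.
  have key : ∀ n, avg (ρ n) (fun x => a x t) y - avg (ρ n) (fun x => a x t) x ≤
      E / t * (y - x) := fun n => by
    have := hE t ht _ ((h n).contDiff_window x y) ((h n).hasCompactSupport_window hxy)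
      ((h n).window_nonneg hxy)
    rw [(h n).integral_window hxy, (h n).deriv_window] at this
    refine le_trans (le_of_eq ?_) this
    have hi : ∀ u, Integrable (fun z => a z t * ρ n (z - u)) := fun u => by
      have := ((h n).integrable_mul_comp_add ha u).comp_sub_right u
      simpa [mul_comm] using this
    simp only [mul_sub]
    rw [integral_sub (hi x) (hi y), IsRightKernel.avg_eq, IsRightKernel.avg_eq]
    simp only [mul_comm]
    ring
  exact le_of_tendsto ((IsRightKernel.tendsto_avg h hε ha (hc y)).sub
    (IsRightKernel.tendsto_avg h hε ha (hc x))) (Eventually.of_forall key)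

end TransportBV

/-! ### Localization in space and time -/

namespace TransportBV

/-- The nearest point projection of `ℝ` onto `[l, r]`. -/
noncomputable def clamp (l r x : ℝ) : ℝ := max l (min x r)

theorem continuous_clamp (l r : ℝ) : Continuous (clamp l r) := by unfold clamp; fun_prop

theorem monotone_clamp (l r : ℝ) : Monotone (clamp l r) := fun x y h => by
  unfold clamp; gcongr

theorem clamp_mem {l r : ℝ} (h : l ≤ r) (x : ℝ) : clamp l r x ∈ Icc l r :=
  ⟨le_max_left _ _, max_le h (min_le_right _ _)⟩

theorem clamp_of_mem {l r x : ℝ} (h : x ∈ Icc l r) : clamp l r x = x := by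
  rw [clamp, min_eq_left h.2, max_eq_right h.1]

theorem clamp_sub_le {l r x y : ℝ} (h : x ≤ y) : clamp l r y - clamp l r x ≤ y - x := by
  unfold clamp
  rcases le_total x r with h1 | h1 <;> rcases le_total y r with h2 | h2 <;>
  rcases le_total l x with h3 | h3 <;> rcases le_total l y with h4 | h4 <;>
  rcases le_total l r with h5 | h5 <;>
  simp [h1, h2, h3, h4, h5] <;> linarith

namespace IsNormalizedBV

variable {u : ℝ → ℝ → ℝ}

/-- The bound depends on the time. For `ψ` no bound uniform in time is assumed, so uniform control
will come from the `L¹` norm only. -/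
theorem exists_bound (hu : IsNormalizedBV u) {t : ℝ} (ht : 0 ≤ t) (R : ℝ) :
    ∃ C : ℝ, ∀ x, |x| ≤ R → |u x t| ≤ C := by
  rcases lt_or_ge R 0 with hR | hR
  · exact ⟨0, fun x hx => absurd (abs_nonneg x) (by linarith)⟩
  have hbv : BoundedVariationOn (fun x => u x t) (univ ∩ Icc (-R) R) :=
    hu.locallyBoundedVariation t ht (-R) R (mem_univ _) (mem_univ _)
  refine ⟨|u 0 t| + (eVariationOn (fun x => u x t) (univ ∩ Icc (-R) R)).toReal, fun x hx => ?_⟩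
  have h1 := hbv.dist_le (x := x) (y := 0) ⟨mem_univ _, abs_le.1 hx⟩
    ⟨mem_univ _, by linarith, hR⟩
  rw [Real.dist_eq] at h1
  have := abs_sub_abs_le_abs_sub (u x t) (u 0 t)
  linarith

theorem measurable_slice (hu : IsNormalizedBV u) (t : ℝ) : Measurable (fun x => u x t) :=
  hu.measurable.comp (measurable_id.prodMk measurable_const)

theorem integrableOn (hu : IsNormalizedBV u) {t : ℝ} (ht : 0 ≤ t) (R : ℝ) :
    IntegrableOn (fun x => u x t) (Icc (-R) R) := by
  obtain ⟨C, hC⟩ := hu.exists_bound ht R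
  refine Measure.integrableOn_of_bounded (M := C) (by simp)
    (hu.measurable_slice t).aestronglyMeasurable ?_
  filter_upwards [ae_restrict_mem measurableSet_Icc] with x hx
  exact hC x (abs_le.2 hx)

theorem locallyIntegrable (hu : IsNormalizedBV u) {t : ℝ} (ht : 0 ≤ t) :
    LocallyIntegrable (fun x => u x t) := by
  rw [locallyIntegrable_iff]
  intro k hk
  obtain ⟨R, hR⟩ := hk.isBounded.subset_closedBall (0 : ℝ)
  rw [Real.closedBall_eq_Icc] at hR
  exact (hu.integrableOn ht R).mono_set (by simpa using hR)

theorem intervalIntegrable (hu : IsNormalizedBV u) {t : ℝ} (ht : 0 ≤ t) (l r : ℝ) :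
    IntervalIntegrable (fun x => u x t) volume l r :=
  ((hu.locallyIntegrable ht).integrableOn_isCompact isCompact_uIcc).intervalIntegrable

end IsNormalizedBV

/-- The density `ψ` cut off outside of `[-R, R]`, and frozen in time outside of `[s, t]`. -/
noncomputable def localDensity (ψ : ℝ → ℝ → ℝ) (R s t τ x : ℝ) : ℝ :=
  (Icc (-R) R).indicator (fun x => ψ x (clamp s t τ)) x

/-- The speed `a`, extended by constants from `[-R, R] × [s, t]`. -/
noncomputable def localSpeed (a : ℝ → ℝ → ℝ) (R s t τ x : ℝ) : ℝ :=
  a (clamp (-R) R x) (clamp s t τ)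

section localDensity

variable {ψ a : ℝ → ℝ → ℝ} {R s t : ℝ}

theorem measurable_localDensity (hψ : IsNormalizedBV ψ) (R s t : ℝ) :
    Measurable (Function.uncurry (localDensity ψ R s t)) := by
  have h1 : Measurable (fun q : ℝ × ℝ => ψ q.2 (clamp s t q.1)) :=
    hψ.measurable.comp (measurable_snd.prodMk
      ((continuous_clamp s t).measurable.comp measurable_fst))
  exact h1.indicator (s := {q : ℝ × ℝ | q.2 ∈ Icc (-R) R}) (measurable_snd measurableSet_Icc)

theorem measurable_localSpeed (ha : IsNormalizedBV a) (R s t : ℝ) :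
    Measurable (Function.uncurry (localSpeed a R s t)) :=
  ha.measurable.comp (((continuous_clamp (-R) R).measurable.comp measurable_snd).prodMk
    ((continuous_clamp s t).measurable.comp measurable_fst))

theorem exists_abs_localDensity_le (hψ : IsNormalizedBV ψ) (hs : 0 ≤ s) (hst : s ≤ t) (R τ : ℝ) :
    ∃ C : ℝ, ∀ x, |localDensity ψ R s t τ x| ≤ C := by
  obtain ⟨C, hC⟩ := hψ.exists_bound (hs.trans (clamp_mem hst τ).1) R
  refine ⟨max C 0, fun x => ?_⟩
  by_cases hx : x ∈ Icc (-R) R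
  · simp only [localDensity, indicator_of_mem hx]
    exact (hC x (abs_le.2 hx)).trans (le_max_left _ _)
  · simp [localDensity, indicator_of_notMem hx]

theorem integrable_localDensity (hψ : IsNormalizedBV ψ) (hs : 0 ≤ s) (hst : s ≤ t) (R τ : ℝ) :
    Integrable (localDensity ψ R s t τ) :=
  (hψ.integrableOn (hs.trans (clamp_mem hst τ).1) R).integrable_indicator measurableSet_Icc

theorem integral_abs_localDensity_sub (ψ : ℝ → ℝ → ℝ) (hR : 0 ≤ R) (s t τ σ : ℝ) :
    ∫ x, |localDensity ψ R s t τ x - localDensity ψ R s t σ x| =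
      ∫ x in (-R)..R, |ψ x (clamp s t τ) - ψ x (clamp s t σ)| := by
  rw [intervalIntegral.integral_of_le (by linarith), ← integral_Icc_eq_integral_Ioc,
    ← integral_indicator measurableSet_Icc]
  congr 1; ext x
  by_cases hx : x ∈ Icc (-R) R
  · simp only [localDensity, indicator_of_mem hx]
  · simp [localDensity, indicator_of_notMem hx]

theorem tendsto_localDensity (hψ : IsBVSolution a ψ) (hR : 0 ≤ R) (hs : 0 ≤ s) (hst : s ≤ t)
    (σ : ℝ) :
    Tendsto (fun τ => ∫ x, |localDensity ψ R s t τ x - localDensity ψ R s t σ x|)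
      (𝓝 σ) (𝓝 0) := by
  simp only [integral_abs_localDensity_sub ψ hR]
  have h1 := hψ.continuousInTime R (clamp s t σ) hR (hs.trans (clamp_mem hst σ).1)
  refine h1.comp (tendsto_nhdsWithin_of_tendsto_nhds_of_eventually_within _
    ((continuous_clamp s t).tendsto σ) (Eventually.of_forall fun τ => ?_))
  exact hs.trans (clamp_mem hst τ).1

theorem continuous_integral_localDensity_mul (hψ : IsBVSolution a ψ) (hR : 0 ≤ R) (hs : 0 ≤ s)
    (hst : s ≤ t) {χ : ℝ → ℝ} (hχ : Continuous χ) {c : ℝ} (hc : ∀ x, |χ x| ≤ c) :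
    Continuous fun τ => ∫ x, localDensity ψ R s t τ x * χ x := by
  have hi : ∀ τ, Integrable (fun x => localDensity ψ R s t τ x * χ x) := fun τ =>
    (integrable_localDensity hψ.normalizedBV hs hst R τ).mul_bdd (c := c)
      hχ.aestronglyMeasurable (Eventually.of_forall hc)
  rw [continuous_iff_continuousAt]
  intro σ
  rw [ContinuousAt, tendsto_iff_norm_sub_tendsto_zero]
  refine squeeze_zero (fun _ => norm_nonneg _) (fun τ => ?_)
    (by simpa using (tendsto_localDensity hψ hR hs hst σ).const_mul c)
  rw [← integral_sub (hi τ) (hi σ), ← integral_const_mul]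
  refine norm_integral_le_of_norm_le (((integrable_localDensity hψ.normalizedBV hs hst R τ).sub
    (integrable_localDensity hψ.normalizedBV hs hst R σ)).abs.const_mul c)
    (Eventually.of_forall fun x => ?_)
  rw [← sub_mul, norm_mul, mul_comm]
  exact mul_le_mul_of_nonneg_right (hc x) (abs_nonneg _)

/-- The `L¹` norm is continuous in time, hence bounded on `[s, t]`; freezing the density outside
`[s, t]` extends the bound to all times. -/
theorem exists_integral_abs_localDensity_le (hψ : IsBVSolution a ψ) (hR : 0 ≤ R) (hs : 0 ≤ s)
    (hst : s ≤ t) : ∃ M : ℝ, ∀ τ, ∫ x, |localDensity ψ R s t τ x| ≤ M := by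
  have hi := integrable_localDensity hψ.normalizedBV hs hst R
  have hcont : Continuous fun τ => ∫ x, |localDensity ψ R s t τ x| := by
    rw [continuous_iff_continuousAt]
    intro σ
    rw [ContinuousAt, tendsto_iff_norm_sub_tendsto_zero]
    refine squeeze_zero (fun _ => norm_nonneg _) (fun τ => ?_)
      (tendsto_localDensity hψ hR hs hst σ)
    rw [← integral_sub (hi τ).abs (hi σ).abs]
    exact norm_integral_le_of_norm_le ((hi τ).sub (hi σ)).abs
      (Eventually.of_forall fun x => abs_abs_sub_abs_le _ _)
  obtain ⟨M, hM⟩ := (isCompact_Icc (a := s) (b := t)).exists_bound_of_continuousOn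
    hcont.continuousOn
  refine ⟨M, fun τ => ?_⟩
  have h1 := hM _ (clamp_mem hst τ)
  have h2 : localDensity ψ R s t (clamp s t τ) = localDensity ψ R s t τ := by
    ext x; simp only [localDensity, clamp_of_mem (clamp_mem hst τ)]
  rw [h2] at h1
  exact (le_abs_self _).trans h1

theorem exists_abs_localSpeed_le (ha : IsLocallyBounded a) (hR : 0 ≤ R) (hs : 0 ≤ s)
    (hst : s ≤ t) : ∃ C : ℝ, 0 ≤ C ∧ ∀ τ x, |localSpeed a R s t τ x| ≤ C := by
  obtain ⟨C, hC⟩ := ha R t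
  have : ∀ τ x, |localSpeed a R s t τ x| ≤ C := fun τ x =>
    hC _ _ (abs_le.2 (clamp_mem (by linarith) x)) (hs.trans (clamp_mem hst τ).1) (clamp_mem hst τ).2
  exact ⟨C, (abs_nonneg _).trans (this 0 0), this⟩

/-- The clamp is monotone and 1-Lipschitz, so the one-sided bound survives. A negative `E` would
not: the extended speed is constant in `x` outside `[-R, R]`, whence `max E 0`. -/
theorem localSpeed_sub_le (ha : IsNormalizedBV a) {E : ℝ} (hE : OleinikBound a E) (hs : 0 < s)
    (hst : s ≤ t) (R τ : ℝ) {x y : ℝ} (hxy : x ≤ y) :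
    localSpeed a R s t τ y - localSpeed a R s t τ x ≤ max E 0 / s * (y - x) := by
  have h0 : s ≤ clamp s t τ := (clamp_mem hst τ).1
  have h1 : 0 < clamp s t τ := hs.trans_le h0
  refine (hE.sub_le h1 (ha.locallyIntegrable h1.le) (ha.rightContinuous _ h1.le)
    (monotone_clamp (-R) R hxy)).trans ?_
  have h2 : 0 ≤ clamp (-R) R y - clamp (-R) R x := sub_nonneg.2 (monotone_clamp _ _ hxy)
  have h3 : E / clamp s t τ ≤ max E 0 / s := by
    refine (div_le_div_of_nonneg_right (le_max_left E 0) h1.le).trans ?_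
    exact div_le_div_of_nonneg_left (le_max_right _ _) hs h0
  exact mul_le_mul h3 (clamp_sub_le hxy) h2 (div_nonneg (le_max_right _ _) hs.le)

theorem continuousWithinAt_localSpeed (ha : IsNormalizedBV a) (hs : 0 ≤ s) (hst : s ≤ t)
    (R τ x : ℝ) : ContinuousWithinAt (localSpeed a R s t τ) (Ici x) x := by
  have h1 := ha.rightContinuous _ (hs.trans (clamp_mem hst τ).1) (clamp (-R) R x)
  exact h1.comp (f := clamp (-R) R) (continuous_clamp _ _).continuousWithinAt
    fun y hy => monotone_clamp _ _ hy

/-- The spatial cutoff can destroy right-continuity only at the end points of `[-R, R]`, a null set.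
-/
theorem continuousWithinAt_localDensity (hψ : IsNormalizedBV ψ) (hs : 0 ≤ s) (hst : s ≤ t)
    (R τ : ℝ) {x : ℝ} (hx : x ≠ R) (hx' : x ≠ -R) :
    ContinuousWithinAt (localDensity ψ R s t τ) (Ici x) x := by
  by_cases h : x ∈ Icc (-R) R
  · have h1 : x ∈ Ioo (-R) R := ⟨lt_of_le_of_ne h.1 hx'.symm, lt_of_le_of_ne h.2 hx⟩
    refine (hψ.rightContinuous _ (hs.trans (clamp_mem hst τ).1) x).congr_of_eventuallyEq ?_ ?_
    · filter_upwards [mem_nhdsWithin_of_mem_nhds (isOpen_Ioo.mem_nhds h1)] with y hy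
      simp [localDensity, Ioo_subset_Icc_self hy]
    · simp [localDensity, h]
  · refine ContinuousAt.continuousWithinAt ?_
    have : localDensity ψ R s t τ =ᶠ[𝓝 x] fun _ => 0 := by
      filter_upwards [isClosed_Icc.isOpen_compl.mem_nhds h] with y hy
      simp only [localDensity]
      exact indicator_of_notMem hy _
    exact continuousAt_const.congr this.symm

end localDensity
end TransportBV

/-! ### The equation tested in space and integrated in time -/

namespace TransportBV

theorem integrable_prod_of_integral_abs_le {F : ℝ → ℝ → ℝ}
    (hF : Measurable (Function.uncurry F)) (hi : ∀ τ, Integrable (F τ)) {l r M : ℝ}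
    (h0 : ∀ τ ∉ Icc l r, F τ = 0) (hM : ∀ τ, ∫ x, |F τ x| ≤ M) :
    Integrable (Function.uncurry F) (volume.prod volume) := by
  rw [integrable_prod_iff hF.aestronglyMeasurable]
  refine ⟨Eventually.of_forall hi, ?_⟩
  have hb : Integrable ((Icc l r).indicator fun _ : ℝ => M) :=
    (integrable_indicator_iff measurableSet_Icc).2 (integrableOn_const (by simp))
  refine hb.mono' hF.stronglyMeasurable.norm.integral_prod_right.aestronglyMeasurable
    (Eventually.of_forall fun τ => ?_)
  rw [Real.norm_of_nonneg (integral_nonneg fun _ => norm_nonneg _)]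
  by_cases hτ : τ ∈ Icc l r
  · rw [indicator_of_mem hτ]; exact hM τ
  · simp [Function.uncurry, h0 τ hτ, indicator_of_notMem hτ]

theorem fderiv_mul_comp_fst_snd {χ W : ℝ → ℝ} (hχ : Differentiable ℝ χ) (hW : Differentiable ℝ W)
    (q v : ℝ × ℝ) : fderiv ℝ (fun q : ℝ × ℝ => χ q.1 * W q.2) q v =
      χ q.1 * deriv W q.2 * v.2 + deriv χ q.1 * W q.2 * v.1 := by
  have h1 : HasFDerivAt (fun q : ℝ × ℝ => χ q.1) _ q :=
    (hχ q.1).hasDerivAt.hasFDerivAt.comp q hasFDerivAt_fst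
  have h2 : HasFDerivAt (fun q : ℝ × ℝ => W q.2) _ q :=
    (hW q.2).hasDerivAt.hasFDerivAt.comp q hasFDerivAt_snd
  have h3 : fderiv ℝ (fun q : ℝ × ℝ => χ q.1 * W q.2) q = _ := (h1.mul h2).fderiv
  rw [h3]
  simp
  ring

theorem deriv_eq_zero_of_notMem_Icc {χ : ℝ → ℝ} {l r : ℝ} (h : ∀ x, x ∉ Icc l r → χ x = 0)
    {x : ℝ} (hx : x ∉ Icc l r) : deriv χ x = 0 := by
  have : χ =ᶠ[𝓝 x] fun _ => 0 := by
    filter_upwards [isClosed_Icc.isOpen_compl.mem_nhds hx] with y hy using h y hy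
  rw [this.deriv_eq, deriv_const]

variable {a ψ : ℝ → ℝ → ℝ} {R s t : ℝ}

/-- The transport equation, tested with `χ(x)` times a smooth function of time. -/
theorem IsBVSolution.integral_test (ha : IsNormalizedBV a)
    (ha_bdd : IsLocallyBounded a) (hψ : IsBVSolution a ψ) (hR : 0 ≤ R) {T : ℝ} (hT : 0 ≤ T)
    {χ W : ℝ → ℝ} (hχ : ContDiff ℝ ∞ χ) (hχ0 : ∀ x, x ∉ Icc (-R) R → χ x = 0)
    (hW : ContDiff ℝ ∞ W) {l r : ℝ} (hl : 0 < l) (hr : r ≤ T) (hW0 : ∀ τ, τ ∉ Icc l r → W τ = 0) :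
    (∫ τ, (∫ x, localDensity ψ R 0 T τ x * χ x) * deriv W τ) +
      ∫ τ, (∫ x, localSpeed a R 0 T τ x * localDensity ψ R 0 T τ x * deriv χ x) * W τ = 0 := by
  have hsub : tsupport (fun q : ℝ × ℝ => χ q.1 * W q.2) ⊆ Icc (-R) R ×ˢ Icc l r := by
    refine closure_minimal (fun q hq => ?_) (isClosed_Icc.prod isClosed_Icc)
    by_contra hn
    rw [mem_prod, not_and_or] at hn
    rcases hn with hn | hn
    · exact hq (by simp [hχ0 _ hn])
    · exact hq (by simp [hW0 _ hn])
  have heq := hψ.equation (fun q => χ q.1 * W q.2)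
    (by have := hχ.comp (contDiff_fst (𝕜 := ℝ) (E := ℝ) (F := ℝ))
        have h2 := hW.comp (contDiff_snd (𝕜 := ℝ) (E := ℝ) (F := ℝ))
        exact this.mul h2)
    (HasCompactSupport.intro (isCompact_Icc.prod isCompact_Icc) fun q hq => by
      by_contra h; exact hq (hsub (subset_tsupport _ h)))
    (fun q hq => hl.trans_le (hsub hq).2.1)
  have hdχ := fun x (hx : x ∉ Icc (-R) R) => deriv_eq_zero_of_notMem_Icc hχ0 hx
  have hdW := fun x (hx : x ∉ Icc l r) => deriv_eq_zero_of_notMem_Icc hW0 hx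
  obtain ⟨c₁, hc₁⟩ := (HasCompactSupport.intro isCompact_Icc hχ0).exists_bound_of_continuous
    hχ.continuous
  obtain ⟨c₂, hc₂⟩ := (HasCompactSupport.intro isCompact_Icc hdχ).exists_bound_of_continuous
    (hχ.continuous_deriv (by simp))
  obtain ⟨c₃, hc₃⟩ := (HasCompactSupport.intro isCompact_Icc hW0).exists_bound_of_continuous
    hW.continuous
  obtain ⟨c₄, hc₄⟩ := (HasCompactSupport.intro isCompact_Icc hdW).exists_bound_of_continuous
    (hW.continuous_deriv (by simp))
  obtain ⟨C, hC0, hC⟩ := exists_abs_localSpeed_le ha_bdd hR le_rfl hT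
  obtain ⟨M, hM⟩ := exists_integral_abs_localDensity_le hψ hR le_rfl hT
  set p := localDensity ψ R 0 T with hp
  set A := localSpeed a R 0 T with hA
  have hpm : Measurable (Function.uncurry p) := measurable_localDensity hψ.normalizedBV R 0 T
  have hAm : Measurable (Function.uncurry A) := measurable_localSpeed ha R 0 T
  have hpi : ∀ τ, Integrable (p τ) := integrable_localDensity hψ.normalizedBV le_rfl hT R
  -- Both terms of the equation are the density times a bounded factor supported in `l ≤ τ ≤ r`, so
  -- the uniform `L¹` bound makes them integrable on the plane.
  have hgen : ∀ (g : ℝ → ℝ → ℝ) (c : ℝ), Measurable (Function.uncurry g) →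
      (∀ τ x, |g τ x| ≤ c) → (∀ τ ∉ Icc l r, g τ = 0) →
      Integrable (Function.uncurry fun τ x => g τ x * p τ x) (volume.prod volume) := by
    intro g c hg hc hg0
    have hi : ∀ τ, Integrable (fun x => g τ x * p τ x) := fun τ =>
      (hpi τ).bdd_mul (c := c) (hg.comp measurable_prodMk_left).aestronglyMeasurable
        (Eventually.of_forall (hc τ))
    refine integrable_prod_of_integral_abs_le (M := c * M) (l := l) (r := r) (hg.mul hpm) hi
      (fun τ hτ => ?_) (fun τ => ?_)
    · ext x; simp [hg0 τ hτ]
    · have hc0 : 0 ≤ c := (abs_nonneg _).trans (hc 0 0)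
      calc ∫ x, |g τ x * p τ x| ≤ ∫ x, c * |p τ x| := by
            refine integral_mono (hi τ).abs ((hpi τ).abs.const_mul c) fun x => ?_
            simp only [abs_mul]
            exact mul_le_mul_of_nonneg_right (hc τ x) (abs_nonneg _)
        _ = c * ∫ x, |p τ x| := integral_const_mul _ _
        _ ≤ c * M := mul_le_mul_of_nonneg_left (hM τ) hc0
  have hi1 : Integrable (Function.uncurry fun τ x => (χ x * deriv W τ) * p τ x)
      (volume.prod volume) := by
    refine hgen _ (c₁ * c₄) ?_ (fun τ x => ?_) fun τ hτ => ?_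
    · exact (hχ.continuous.measurable.comp measurable_snd).mul
        ((hW.continuous_deriv (by simp)).measurable.comp measurable_fst)
    · rw [abs_mul]
      exact mul_le_mul (hc₁ x) (hc₄ τ) (abs_nonneg _) ((norm_nonneg _).trans (hc₁ 0))
    · ext x; simp [hdW τ hτ]
  have hi2 : Integrable (Function.uncurry fun τ x => (A τ x * (deriv χ x * W τ)) * p τ x)
      (volume.prod volume) := by
    refine hgen _ (C * (c₂ * c₃)) ?_ (fun τ x => ?_) fun τ hτ => ?_
    · exact hAm.mul (((hχ.continuous_deriv (by simp)).measurable.comp measurable_snd).mul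
        (hW.continuous.measurable.comp measurable_fst))
    · rw [abs_mul, abs_mul]
      exact mul_le_mul (hC τ x) (mul_le_mul (hc₂ x) (hc₃ τ) (abs_nonneg _)
        ((norm_nonneg _).trans (hc₂ 0))) (by positivity) hC0
    · ext x; simp [hW0 τ hτ]
  have hpt : ∀ q : ℝ × ℝ,
      (ψ q.1 q.2 * fderiv ℝ (fun q : ℝ × ℝ => χ q.1 * W q.2) q (0, 1) +
        a q.1 q.2 * ψ q.1 q.2 * fderiv ℝ (fun q : ℝ × ℝ => χ q.1 * W q.2) q (1, 0)) =
      (χ q.1 * deriv W q.2) * p q.2 q.1 + (A q.2 q.1 * (deriv χ q.1 * W q.2)) * p q.2 q.1 := by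
    rintro ⟨x, τ⟩
    rw [fderiv_mul_comp_fst_snd (hχ.differentiable (by simp)) (hW.differentiable (by simp)),
      fderiv_mul_comp_fst_snd (hχ.differentiable (by simp)) (hW.differentiable (by simp))]
    by_cases hx : x ∈ Icc (-R) R
    · by_cases hτ : τ ∈ Icc l r
      · have hτ' : τ ∈ Icc 0 T := ⟨hl.le.trans hτ.1, hτ.2.trans hr⟩
        simp only [hp, hA, localDensity, localSpeed, indicator_of_mem hx, clamp_of_mem hx,
          clamp_of_mem hτ']
        ring
      · simp [hW0 τ hτ, hdW τ hτ]
    · simp [hχ0 x hx, hdχ x hx]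
  simp only [hpt] at heq
  have hsw : ∫ q : ℝ × ℝ, ((χ q.1 * deriv W q.2) * p q.2 q.1 +
      (A q.2 q.1 * (deriv χ q.1 * W q.2)) * p q.2 q.1) =
      ∫ q : ℝ × ℝ, ((χ q.2 * deriv W q.1) * p q.1 q.2 +
      (A q.1 q.2 * (deriv χ q.2 * W q.1)) * p q.1 q.2) := by
    exact integral_prod_swap (μ := (volume : Measure ℝ)) (ν := (volume : Measure ℝ))
      (fun q : ℝ × ℝ => (χ q.2 * deriv W q.1) * p q.1 q.2 +
        (A q.1 q.2 * (deriv χ q.2 * W q.1)) * p q.1 q.2)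
  rw [hsw, integral_add (by exact hi1) (by exact hi2)] at heq
  have e1 := integral_prod _ hi1
  have e2 := integral_prod _ hi2
  simp only [Function.uncurry] at e1 e2
  rw [Measure.volume_eq_prod, e1, e2] at heq
  rw [← heq]
  congr 1
  · refine integral_congr_ae (Eventually.of_forall fun τ => ?_)
    simp only
    rw [← integral_mul_const]
    congr 1; ext x; ring
  · refine integral_congr_ae (Eventually.of_forall fun τ => ?_)
    simp only
    rw [← integral_mul_const]
    congr 1; ext x; ring

theorem measurable_flux (ha : IsNormalizedBV a) (hψ : IsNormalizedBV ψ) {g : ℝ → ℝ}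
    (hg : Measurable g) (R s t : ℝ) :
    Measurable fun τ => ∫ x, localSpeed a R s t τ x * localDensity ψ R s t τ x * g x :=
  (((measurable_localSpeed ha R s t).mul (measurable_localDensity hψ R s t)).mul
    (hg.comp measurable_snd)).stronglyMeasurable.integral_prod_right.measurable

theorem exists_abs_flux_le (ha_bdd : IsLocallyBounded a) (hψ : IsBVSolution a ψ) (hR : 0 ≤ R)
    (hs : 0 ≤ s) (hst : s ≤ t) (c : ℝ) :
    ∃ B, ∀ g : ℝ → ℝ, (∀ x, |g x| ≤ c) → ∀ τ,
      |∫ x, localSpeed a R s t τ x * localDensity ψ R s t τ x * g x| ≤ B := by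
  obtain ⟨C, hC0, hC⟩ := exists_abs_localSpeed_le ha_bdd hR hs hst
  obtain ⟨M, hM⟩ := exists_integral_abs_localDensity_le hψ hR hs hst
  refine ⟨C * c * M, fun g hc τ => ?_⟩
  have hc0 : 0 ≤ c := (abs_nonneg _).trans (hc 0)
  calc |∫ x, localSpeed a R s t τ x * localDensity ψ R s t τ x * g x|
      ≤ ∫ x, C * c * |localDensity ψ R s t τ x| := by
        rw [← Real.norm_eq_abs]
        refine norm_integral_le_of_norm_le ((integrable_localDensity hψ.normalizedBV hs hst
          R τ).abs.const_mul _) (Eventually.of_forall fun x => ?_)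
        rw [norm_mul, norm_mul, mul_right_comm]
        exact mul_le_mul_of_nonneg_right (mul_le_mul (hC τ x) (hc x) (abs_nonneg _) hC0)
          (abs_nonneg _)
    _ = C * c * ∫ x, |localDensity ψ R s t τ x| := integral_const_mul _ _
    _ ≤ C * c * M := mul_le_mul_of_nonneg_left (hM τ) (by positivity)

/-- The transport equation, tested with a function of `x` and integrated in time. -/
theorem IsBVSolution.integral_localDensity_sub (ha : IsNormalizedBV a)
    (ha_bdd : IsLocallyBounded a) (hψ : IsBVSolution a ψ) (hR : 0 ≤ R) (hs : 0 < s)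
    {χ : ℝ → ℝ} (hχ : ContDiff ℝ ∞ χ) (hχ0 : ∀ x, x ∉ Icc (-R) R → χ x = 0) {t₁ t₂ : ℝ}
    (h₁ : s ≤ t₁) (h₁₂ : t₁ ≤ t₂) (h₂ : t₂ ≤ t) :
    (∫ x, localDensity ψ R s t t₂ x * χ x) - ∫ x, localDensity ψ R s t t₁ x * χ x =
      ∫ τ in t₁..t₂, ∫ x, localSpeed a R s t τ x * localDensity ψ R s t τ x * deriv χ x := by
  obtain ⟨ρ, ε, h, hε⟩ := exists_isRightKernel_seq
  -- The time window on `[t₁, t₂]` reaches up to `t₂ + ε n`, possibly past `t`. The density and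
  -- speed are therefore frozen on `[0, t + 1]` instead; on `[t₁, t₂]` the two versions agree.
  have hT : 0 ≤ t + 1 := by linarith
  have hsame : ∀ τ ∈ Icc t₁ t₂, clamp 0 (t + 1) τ = clamp s t τ := fun τ hτ => by
    rw [clamp_of_mem ⟨by linarith [hτ.1], by linarith [hτ.2]⟩,
      clamp_of_mem ⟨by linarith [hτ.1], by linarith [hτ.2]⟩]
  have hp : ∀ τ ∈ Icc t₁ t₂, localDensity ψ R s t τ = localDensity ψ R 0 (t + 1) τ :=
    fun τ hτ => by ext x; simp only [localDensity, hsame τ hτ]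
  have hA : ∀ τ ∈ Icc t₁ t₂, localSpeed a R s t τ = localSpeed a R 0 (t + 1) τ :=
    fun τ hτ => by ext x; simp only [localSpeed, hsame τ hτ]
  rw [hp t₂ ⟨h₁₂, le_rfl⟩, hp t₁ ⟨le_rfl, h₁₂⟩]
  have hr : ∫ τ in t₁..t₂, ∫ x, localSpeed a R s t τ x * localDensity ψ R s t τ x * deriv χ x =
      ∫ τ in t₁..t₂, ∫ x, localSpeed a R 0 (t + 1) τ x * localDensity ψ R 0 (t + 1) τ x *
        deriv χ x := by
    refine intervalIntegral.integral_congr fun τ hτ => ?_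
    rw [uIcc_of_le h₁₂] at hτ
    simp only [hp τ hτ, hA τ hτ]
  rw [hr]
  have hdχ := fun x (hx : x ∉ Icc (-R) R) => deriv_eq_zero_of_notMem_Icc hχ0 hx
  obtain ⟨c₁, hc₁⟩ := (HasCompactSupport.intro isCompact_Icc hχ0).exists_bound_of_continuous
    hχ.continuous
  have hχc := hχ.continuous_deriv (by simp)
  obtain ⟨c₂, hc₂⟩ := (HasCompactSupport.intro isCompact_Icc hdχ).exists_bound_of_continuous hχc
  have hf := continuous_integral_localDensity_mul hψ hR le_rfl hT hχ.continuous hc₁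
  have hm := measurable_flux ha hψ.normalizedBV hχc.measurable R 0 (t + 1)
  obtain ⟨B, hB'⟩ := exists_abs_flux_le ha_bdd hψ hR le_rfl hT c₂
  have hB := hB' _ hc₂
  set f := fun τ => ∫ x, localDensity ψ R 0 (t + 1) τ x * χ x
  set k := fun τ => ∫ x, localSpeed a R 0 (t + 1) τ x * localDensity ψ R 0 (t + 1) τ x *
        deriv χ x
  -- With a window as test function in time, the term with the time derivative is a difference of
  -- averages of the continuous function `f`, and the flux term tends to the integral over `(t₁,
  -- t₂]`.
  have hev : ∀ᶠ n in atTop, (avg (ρ n) f t₁ - avg (ρ n) f t₂) +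
      ∫ τ, k τ * window (ρ n) t₁ t₂ τ = 0 := by
    filter_upwards [hε.eventually (gt_mem_nhds one_pos)] with n hn
    have := hψ.integral_test ha ha_bdd hR hT hχ hχ0 ((h n).contDiff_window t₁ t₂)
      (hs.trans_le h₁) (by linarith : t₂ + ε n ≤ t + 1) fun τ hτ => (h n).window_eq_zero h₁₂ hτ
    rw [← this]
    congr 1
    have hi : ∀ u, Integrable (fun z => f z * ρ n (z - u)) := fun u => by
      have := ((h n).integrable_mul_comp_add hf.locallyIntegrable u).comp_sub_right u
      simpa [mul_comm] using this
    rw [(h n).deriv_window]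
    simp only [mul_sub]
    rw [integral_sub (hi t₁) (hi t₂), IsRightKernel.avg_eq, IsRightKernel.avg_eq]
    simp only [mul_comm]
  have l1 : ∀ u, Tendsto (fun n => avg (ρ n) f u) atTop (𝓝 (f u)) := fun u =>
    IsRightKernel.tendsto_avg h hε hf.locallyIntegrable hf.continuousWithinAt
  have l2 : Tendsto (fun n => ∫ τ, k τ * window (ρ n) t₁ t₂ τ) atTop
      (𝓝 (∫ τ, k τ * (Ioc t₁ t₂).indicator 1 τ)) := by
    refine tendsto_integral_filter_of_dominated_convergence
      ((Icc t₁ (t₂ + 1)).indicator fun _ => B) ?_ ?_ ?_ ?_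
    · exact Eventually.of_forall fun n =>
        (hm.mul ((h n).contDiff_window t₁ t₂).continuous.measurable).aestronglyMeasurable
    · filter_upwards [hε.eventually (gt_mem_nhds one_pos)] with n hn
      refine Eventually.of_forall fun τ => ?_
      by_cases hτ : τ ∈ Icc t₁ (t₂ + 1)
      · rw [indicator_of_mem hτ, norm_mul, Real.norm_of_nonneg ((h n).window_nonneg h₁₂ τ)]
        exact (mul_le_of_le_one_right (norm_nonneg _) ((h n).window_le_one h₁₂ τ)).trans (hB τ)
      · rw [indicator_of_notMem hτ, (h n).window_eq_zero h₁₂ fun hτ' =>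
          hτ ⟨hτ'.1, by linarith [hτ'.2]⟩]
        simp
    · exact (integrable_indicator_iff measurableSet_Icc).2 (integrableOn_const (by simp))
    · exact Eventually.of_forall fun τ =>
        (IsRightKernel.tendsto_window h hε h₁₂).const_mul _
  have e3 : ∫ τ, k τ * (Ioc t₁ t₂).indicator 1 τ = ∫ τ in t₁..t₂, k τ := by
    rw [intervalIntegral.integral_of_le h₁₂, ← integral_indicator measurableSet_Ioc]
    congr 1; ext τ
    by_cases hτ : τ ∈ Ioc t₁ t₂ <;> simp [hτ]
  have lim := ((l1 t₁).sub (l1 t₂)).add l2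
  have := tendsto_nhds_unique (lim.congr' hev) tendsto_const_nhds
  rw [e3] at this
  linarith

end TransportBV

/-! ### Gronwall and Carathéodory -/

namespace TransportBV

/-- A one-sided integral Gronwall inequality, for a function which need only satisfy the
integral inequality while it is above the threshold `θ`. -/
theorem le_max_mul_exp_of_sub_le_integral {w : ℝ → ℝ} {s t K θ : ℝ} (hK : 0 ≤ K) (hθ : 0 ≤ θ)
    (hst : s ≤ t) (hw : ContinuousOn w (Icc s t))
    (H : ∀ τ₁ τ₂, s ≤ τ₁ → τ₁ ≤ τ₂ → τ₂ ≤ t → (∀ τ ∈ Ioc τ₁ τ₂, θ < w τ) →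
      w τ₂ - w τ₁ ≤ ∫ τ in τ₁..τ₂, K * w τ) :
    w t ≤ max (w s) θ * Real.exp (K * (t - s)) := by
  set m := max (w s) θ with hm
  have hm0 : 0 ≤ m := hθ.trans (le_max_right _ _)
  have hexp : 1 ≤ Real.exp (K * (t - s)) :=
    Real.one_le_exp (mul_nonneg hK (sub_nonneg.2 hst))
  rcases le_or_gt (w t) m with hwt | hwt
  · exact hwt.trans (le_mul_of_one_le_right hm0 hexp)
  have hcpt : IsCompact (Icc s t ∩ w ⁻¹' Iic m) :=
    isCompact_Icc.of_isClosed_subset (hw.preimage_isClosed_of_isClosed isClosed_Icc isClosed_Iic)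
      inter_subset_left
  -- `τ₀` is the last time at which `w ≤ m`. After it `w` exceeds `m ≥ θ`, so the integral
  -- inequality is available on all of `(τ₀, t]`.
  obtain ⟨τ₀, ⟨hτ₀, hwτ₀⟩, hmax⟩ :=
    hcpt.exists_isGreatest ⟨s, ⟨le_rfl, hst⟩, mem_preimage.2 (mem_Iic.2 (le_max_left _ _))⟩
  have habove : ∀ τ ∈ Ioc τ₀ t, θ < w τ := fun τ hτ => by
    by_contra! h
    have := hmax ⟨⟨hτ₀.1.trans hτ.1.le, hτ.2⟩, h.trans (le_max_right _ _)⟩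
    linarith [hτ.1]
  have hcont : Continuous fun τ => w (clamp s t τ) :=
    hw.comp_continuous (continuous_clamp s t) (clamp_mem hst)
  -- `w` is only continuous, so Gronwall is applied to this differentiable majorant, for which `V' =
  -- K w ≤ K V`. The clamp makes the integrand continuous on the whole line.
  set V : ℝ → ℝ := fun τ => m + ∫ σ in τ₀..τ, K * w (clamp s t σ) with hV
  have hVd : ∀ τ, HasDerivAt V (K * w (clamp s t τ)) τ := fun τ =>
    ((continuous_const.mul hcont).integral_hasStrictDerivAt τ₀ τ).hasDerivAt.const_add m
  have hle : ∀ τ ∈ Icc τ₀ t, w τ ≤ V τ := fun τ hτ => by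
    have h1 := H τ₀ τ hτ₀.1 hτ.1 hτ.2 fun σ hσ => habove σ ⟨hσ.1, hσ.2.trans hτ.2⟩
    have h2 : ∫ σ in τ₀..τ, K * w (clamp s t σ) = ∫ σ in τ₀..τ, K * w σ := by
      refine intervalIntegral.integral_congr fun σ hσ => ?_
      rw [uIcc_of_le hτ.1] at hσ
      simp only [clamp_of_mem (l := s) (r := t) ⟨hτ₀.1.trans hσ.1, hσ.2.trans hτ.2⟩]
    have h3 : w τ₀ ≤ m := hwτ₀
    simp only [hV, h2]
    linarith
  have hgr := le_gronwallBound_of_liminf_deriv_right_le (f := V)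
    (f' := fun τ => K * w (clamp s t τ)) (δ := m) (K := K) (ε := 0) (a := τ₀) (b := t)
    (fun τ _ => (hVd τ).continuousAt.continuousWithinAt)
    (fun τ _ r hr => (hVd τ).hasDerivWithinAt.liminf_right_slope_le hr) (by simp [hV])
    (fun τ hτ => by
      rw [clamp_of_mem ⟨hτ₀.1.trans hτ.1, hτ.2.le⟩, add_zero]
      exact mul_le_mul_of_nonneg_left (hle τ ⟨hτ.1, hτ.2.le⟩) hK)
    t ⟨hτ₀.2, le_rfl⟩
  rw [gronwallBound_ε0] at hgr
  refine (hle t ⟨hτ₀.2, le_rfl⟩).trans (hgr.trans ?_)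
  gcongr
  exact hτ₀.1

theorem measurable_comp_graph {v : ℝ → ℝ → ℝ} (hv : Measurable (Function.uncurry v)) {Y : ℝ → ℝ}
    (hY : Continuous Y) : Measurable fun σ => v σ (Y σ) :=
  hv.comp (measurable_id.prodMk hY.measurable)

theorem intervalIntegrable_of_abs_le {f : ℝ → ℝ} (hf : Measurable f) {C : ℝ}
    (hC : ∀ σ, |f σ| ≤ C) (l r : ℝ) : IntervalIntegrable f volume l r :=
  (intervalIntegrable_const (c := C)).mono_fun' hf.aestronglyMeasurable (Eventually.of_forall hC)

theorem continuous_primitive_of_abs_le {f : ℝ → ℝ} (hf : Measurable f) {C : ℝ}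
    (hC : ∀ σ, |f σ| ≤ C) (l : ℝ) : Continuous fun r => ∫ σ in l..r, f σ :=
  intervalIntegral.continuous_primitive (fun _ _ => intervalIntegrable_of_abs_le hf hC _ _) l

theorem abs_integral_le_of_abs_le {f : ℝ → ℝ} {C : ℝ} (hC : ∀ σ, |f σ| ≤ C) (l r : ℝ) :
    |∫ σ in l..r, f σ| ≤ C * |r - l| :=
  intervalIntegral.norm_integral_le_of_norm_le_const (f := f) fun σ _ => hC σ

/-- Carathéodory's existence theorem, for a bounded vector field which is measurable in time and
Lipschitz in space. -/
theorem exists_forward_solution {v : ℝ → ℝ → ℝ} (hv : Measurable (Function.uncurry v)) {C L : ℝ}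
    (hC : ∀ σ y, |v σ y| ≤ C) (hL0 : 0 ≤ L) (hL : ∀ σ y z, |v σ y - v σ z| ≤ L * |y - z|) (x : ℝ) :
    ∃ Z : ℝ → ℝ, Continuous Z ∧ ∀ τ, 0 ≤ τ → Z τ = x + ∫ σ in (0 : ℝ)..τ, v σ (Z σ) := by
  -- Exponential weight: the unknown is `Y τ = exp (-l τ) Z τ`, for which the integral operator has
  -- Lipschitz constant at most `L / l ≤ 1/2` globally in time.
  set l : ℝ := 2 * L + 1 with hl
  have hl0 : 0 < l := by positivity
  have hC0 : 0 ≤ C := (abs_nonneg _).trans (hC 0 0)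
  have hYc : ∀ Y : BoundedContinuousFunction ℝ ℝ, Continuous fun σ => Real.exp (l * σ) * Y σ :=
    fun Y => by fun_prop
  -- Replacing `τ` by `max τ 0` makes the image constant for negative times, so that it is bounded
  -- on the whole line.
  let f : BoundedContinuousFunction ℝ ℝ → ℝ → ℝ := fun Y τ =>
    Real.exp (-(l * max τ 0)) * (x + ∫ σ in (0 : ℝ)..(max τ 0), v σ (Real.exp (l * σ) * Y σ))
  have hfc : ∀ Y, Continuous (f Y) := fun Y => by
    have := (continuous_primitive_of_abs_le (measurable_comp_graph hv (hYc Y))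
      (fun σ => hC σ _) 0).comp (continuous_id.max (continuous_const (y := (0 : ℝ))))
    exact Continuous.mul (by fun_prop) (continuous_const.add this)
  have hfb : ∀ Y τ, ‖f Y τ‖ ≤ |x| + C / l := fun Y τ => by
    set u := max τ 0 with hu
    have hu0 : 0 ≤ u := le_max_right _ _
    have h1 := abs_integral_le_of_abs_le (fun σ => hC σ (Real.exp (l * σ) * Y σ)) 0 u
    rw [sub_zero, abs_of_nonneg hu0] at h1
    have h2 : Real.exp (-(l * u)) ≤ 1 := Real.exp_le_one_iff.2 (by nlinarith)
    have h3 : Real.exp (-(l * u)) * u ≤ 1 / l := by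
      rw [Real.exp_neg, inv_mul_le_iff₀ (Real.exp_pos _), mul_one_div, le_div_iff₀ hl0]
      linarith [Real.add_one_le_exp (l * u)]
    calc ‖f Y τ‖ = Real.exp (-(l * u)) *
          |x + ∫ σ in (0 : ℝ)..u, v σ (Real.exp (l * σ) * Y σ)| := by
          simp only [f, norm_mul, Real.norm_eq_abs, Real.abs_exp, hu]
      _ ≤ Real.exp (-(l * u)) * (|x| + C * u) := by
          gcongr; exact (abs_add_le _ _).trans (by gcongr)
      _ = Real.exp (-(l * u)) * |x| + C * (Real.exp (-(l * u)) * u) := by ring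
      _ ≤ 1 * |x| + C * (1 / l) := by gcongr
      _ = |x| + C / l := by ring
  let F : BoundedContinuousFunction ℝ ℝ → BoundedContinuousFunction ℝ ℝ := fun Y =>
    BoundedContinuousFunction.ofNormedAddCommGroup (f Y) (hfc Y) _ (hfb Y)
  have hF : ContractingWith (1 / 2) F := by
    refine ⟨by
      rw [← NNReal.coe_lt_coe]; norm_num, LipschitzWith.of_dist_le_mul fun Y Y' => ?_⟩
    rw [BoundedContinuousFunction.dist_le (by positivity)]
    intro τ
    change dist (f Y τ) (f Y' τ) ≤ _
    set u := max τ 0 with hu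
    have hu0 : 0 ≤ u := le_max_right _ _
    have hi : ∀ Y : BoundedContinuousFunction ℝ ℝ, IntervalIntegrable
        (fun σ => v σ (Real.exp (l * σ) * Y σ)) volume 0 u := fun Y =>
      intervalIntegrable_of_abs_le (measurable_comp_graph hv (hYc Y)) (fun σ => hC σ _) _ _
    have hE : Continuous fun σ => L * dist Y Y' * Real.exp (l * σ) := by fun_prop
    have h1 : |∫ σ in (0 : ℝ)..u, (v σ (Real.exp (l * σ) * Y σ) - v σ (Real.exp (l * σ) * Y' σ))|
        ≤ ∫ σ in (0 : ℝ)..u, L * dist Y Y' * Real.exp (l * σ) := by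
      rw [← Real.norm_eq_abs]
      refine intervalIntegral.norm_integral_le_of_norm_le hu0 (Eventually.of_forall fun σ _ => ?_)
        (hE.intervalIntegrable _ _)
      refine (hL σ _ _).trans ?_
      rw [← mul_sub, abs_mul, Real.abs_exp, mul_assoc, mul_comm (dist Y Y')]
      gcongr
      exact BoundedContinuousFunction.dist_coe_le_dist (f := Y) (g := Y') σ
    have h2 : ∫ σ in (0 : ℝ)..u, L * dist Y Y' * Real.exp (l * σ) =
        L * dist Y Y' * ((Real.exp (l * u) - 1) / l) := by
      rw [intervalIntegral.integral_const_mul, intervalIntegral.integral_comp_mul_left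
        (fun σ => Real.exp σ) hl0.ne',
        integral_exp]
      simp; left; field_simp
    rw [Real.dist_eq]
    simp only [f, ← hu]
    rw [← mul_sub, add_sub_add_left_eq_sub, ← intervalIntegral.integral_sub (hi Y) (hi Y'),
      abs_mul, Real.abs_exp]
    calc Real.exp (-(l * u)) * |∫ σ in (0 : ℝ)..u, (v σ (Real.exp (l * σ) * Y σ) -
            v σ (Real.exp (l * σ) * Y' σ))|
        ≤ Real.exp (-(l * u)) * (L * dist Y Y' * (Real.exp (l * u) / l)) := by
          rw [h2] at h1
          gcongr
          refine h1.trans ?_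
          gcongr
          linarith
      _ = L / l * dist Y Y' := by
          rw [Real.exp_neg]; field_simp
      _ ≤ ((1 / 2 : NNReal) : ℝ) * dist Y Y' := by
          gcongr
          rw [div_le_iff₀ hl0]; push_cast; linarith
  obtain ⟨Y, hY⟩ : ∃ Y, F Y = Y := ⟨_, hF.fixedPoint_isFixedPt⟩
  refine ⟨fun σ => Real.exp (l * σ) * Y σ, hYc Y, fun τ hτ => ?_⟩
  have h1 : Y τ = f Y τ := (DFunLike.congr_fun hY τ).symm
  beta_reduce
  rw [h1]
  simp only [f, max_eq_left hτ]
  rw [← mul_assoc, ← Real.exp_add, add_neg_cancel, Real.exp_zero, one_mul]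

/-- Solutions of an ordinary differential equation with prescribed value at the final time `t`. -/
theorem exists_backward_solution {b : ℝ → ℝ → ℝ} (hb : Measurable (Function.uncurry b)) {C L : ℝ}
    (hC : ∀ σ y, |b σ y| ≤ C) (hL0 : 0 ≤ L) (hL : ∀ σ y z, |b σ y - b σ z| ≤ L * |y - z|)
    (t x : ℝ) : ∃ X : ℝ → ℝ, Continuous X ∧ X t = x ∧
      ∀ τ₁ τ₂, τ₁ ≤ t → τ₂ ≤ t → X τ₂ - X τ₁ = ∫ σ in τ₁..τ₂, b σ (X σ) := by
  obtain ⟨Z, hZ, hZeq⟩ := exists_forward_solution (v := fun σ y => -b (t - σ) y)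
    (by exact (hb.comp ((measurable_const.sub measurable_fst).prodMk measurable_snd)).neg)
    (fun σ y => by rw [abs_neg]; exact hC _ _) hL0
    (fun σ y z => by rw [neg_sub_neg, abs_sub_comm]; exact hL _ _ _) x
  have hXc : Continuous fun τ => Z (t - τ) := hZ.comp (by fun_prop)
  have hX : ∀ τ ≤ t, Z (t - τ) = x - ∫ σ in τ..t, b σ (Z (t - σ)) := fun τ hτ => by
    rw [hZeq _ (by linarith), intervalIntegral.integral_neg]
    have := intervalIntegral.integral_comp_sub_left (a := 0) (b := t - τ)
      (fun σ => b σ (Z (t - σ))) t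
    simp only [sub_sub_cancel, sub_zero] at this
    rw [this, sub_eq_add_neg]
  refine ⟨fun τ => Z (t - τ), hXc, by simpa using hZeq 0 le_rfl, fun τ₁ τ₂ h₁ h₂ => ?_⟩
  have hi : ∀ l r, IntervalIntegrable (fun σ => b σ (Z (t - σ))) volume l r :=
    intervalIntegrable_of_abs_le (measurable_comp_graph hb hXc) fun σ => hC σ _
  simp only [hX τ₁ h₁, hX τ₂ h₂]
  rw [← intervalIntegral.integral_add_adjacent_intervals (hi τ₁ τ₂) (hi τ₂ t)]
  ring

end TransportBV

/-! ### Trajectories of the smoothed speed and their barriers -/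

namespace TransportBV

/-- `X` solves `X' = b(τ, X)` (in integral form) for times up to `t`. -/
structure IsTrajectory (b : ℝ → ℝ → ℝ) (t : ℝ) (X : ℝ → ℝ) : Prop where
  continuous : Continuous X
  sub_eq : ∀ τ₁ τ₂, τ₁ ≤ t → τ₂ ≤ t → X τ₂ - X τ₁ = ∫ σ in τ₁..τ₂, b σ (X σ)

variable {a ψ : ℝ → ℝ → ℝ} {R s t : ℝ} {ρ : ℝ → ℝ} {ε : ℝ}

theorem locallyIntegrable_of_abs_le {f : ℝ → ℝ} (hf : Measurable f) {C : ℝ}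
    (hC : ∀ x, |f x| ≤ C) : LocallyIntegrable f :=
  (locallyIntegrable_const C).mono hf.aestronglyMeasurable
    (Eventually.of_forall fun x => (hC x).trans (le_abs_self C))

theorem locallyIntegrable_localSpeed (ha : IsNormalizedBV a) (ha_bdd : IsLocallyBounded a)
    (hR : 0 ≤ R) (hs : 0 ≤ s) (hst : s ≤ t) (τ : ℝ) :
    LocallyIntegrable (localSpeed a R s t τ) := by
  obtain ⟨C, -, hC⟩ := exists_abs_localSpeed_le ha_bdd hR hs hst
  exact locallyIntegrable_of_abs_le
    ((measurable_localSpeed ha R s t).comp measurable_prodMk_left) (hC τ)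

/-- The difference of the two translated kernels lives on two intervals of length `ε`, so a bounded
`f` suffices. This serves the speed, which the constant extension makes non-integrable in general.
-/
theorem IsRightKernel.abs_avg_sub_le_of_abs_le (h : IsRightKernel ρ ε) {L : ℝ} (hL0 : 0 ≤ L)
    (hL : ∀ x y, |ρ x - ρ y| ≤ L * |x - y|) {f : ℝ → ℝ} (hf : Measurable f) {C : ℝ}
    (hC : ∀ x, |f x| ≤ C) (x y : ℝ) :
    |avg ρ f x - avg ρ f y| ≤ 2 * ε * C * L * |x - y| := by
  have hfl := locallyIntegrable_of_abs_le hf hC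
  have hC0 : 0 ≤ C := (abs_nonneg _).trans (hC 0)
  have hi : ∀ x, Integrable (fun z => ρ (z - x) * f z) := fun x => by
    have := (h.integrable_mul_comp_add hfl x).comp_sub_right x
    simpa using this
  have hI' : ∀ u : ℝ, Integrable ((Icc u (u + ε)).indicator fun _ => C * L * |x - y|) := fun u =>
    (integrable_indicator_iff measurableSet_Icc).2 (integrableOn_const (by simp))
  have hv : ∀ u : ℝ, ∫ z, (Icc u (u + ε)).indicator (fun _ => C * L * |x - y|) z =
      ε * (C * L * |x - y|) := fun u => by
    rw [integral_indicator measurableSet_Icc]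
    simp [h.nonneg_width]
  rw [IsRightKernel.avg_eq, IsRightKernel.avg_eq, ← integral_sub (hi x) (hi y)]
  calc |∫ z, (ρ (z - x) * f z - ρ (z - y) * f z)|
      ≤ ∫ z, ((Icc x (x + ε)).indicator (fun _ => C * L * |x - y|) z +
          (Icc y (y + ε)).indicator (fun _ => C * L * |x - y|) z) := by
        rw [← Real.norm_eq_abs]
        refine norm_integral_le_of_norm_le ((hI' x).add (hI' y))
          (Eventually.of_forall fun z => ?_)
        have hc : 0 ≤ C * L * |x - y| := by positivity
        have hb : ‖ρ (z - x) * f z - ρ (z - y) * f z‖ ≤ C * L * |x - y| := by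
          rw [Real.norm_eq_abs, ← sub_mul, abs_mul, mul_comm, mul_assoc]
          refine mul_le_mul (hC z) ((hL _ _).trans_eq ?_) (abs_nonneg _) hC0
          rw [abs_sub_comm x y]; congr 2; ring
        have hn : ∀ u, 0 ≤ (Icc u (u + ε)).indicator (fun _ => C * L * |x - y|) z := fun u =>
          indicator_nonneg (fun _ _ => hc) z
        by_cases hx : z ∈ Icc x (x + ε)
        · rw [indicator_of_mem hx]
          linarith [hn y]
        · by_cases hy : z ∈ Icc y (y + ε)
          · rw [indicator_of_mem hy]
            linarith [hn x]
          · rw [h.eq_zero (z - x) fun hz => hx ⟨by linarith [hz.1], by linarith [hz.2]⟩,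
              h.eq_zero (z - y) fun hz => hy ⟨by linarith [hz.1], by linarith [hz.2]⟩]
            simpa using add_nonneg (hn x) (hn y)
    _ = 2 * ε * C * L * |x - y| := by
        rw [integral_add (hI' x) (hI' y), hv, hv]; ring

theorem measurable_avg_localSpeed (h : IsRightKernel ρ ε) (ha : IsNormalizedBV a) (R s t : ℝ) :
    Measurable (Function.uncurry fun τ => avg ρ (localSpeed a R s t τ)) :=
  h.measurable_avg (measurable_localSpeed ha R s t)

theorem exists_trajectory (h : IsRightKernel ρ ε) (ha : IsNormalizedBV a)
    (ha_bdd : IsLocallyBounded a) (hR : 0 ≤ R) (hs : 0 ≤ s) (hst : s ≤ t) (x : ℝ) :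
    ∃ X, IsTrajectory (fun τ => avg ρ (localSpeed a R s t τ)) t X ∧ X t = x := by
  obtain ⟨C, hC0, hC⟩ := exists_abs_localSpeed_le ha_bdd hR hs hst
  obtain ⟨L, hL0, hL⟩ := h.exists_lipschitz
  have hm : ∀ τ, Measurable (localSpeed a R s t τ) := fun τ =>
    (measurable_localSpeed ha R s t).comp measurable_prodMk_left
  have h0 := h.nonneg_width
  obtain ⟨X, hX, hXt, hXe⟩ := exists_backward_solution (measurable_avg_localSpeed h ha R s t)
    (C := C) (L := 2 * ε * C * L)
    (fun σ y => h.abs_avg_le (locallyIntegrable_localSpeed ha ha_bdd hR hs hst σ)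
      fun z _ => hC σ _)
    (by positivity) (fun σ => h.abs_avg_sub_le_of_abs_le hL0 hL (hm σ) (hC σ)) t x
  exact ⟨X, ⟨hX, hXe⟩, hXt⟩

theorem intervalIntegrable_avg_localSpeed (h : IsRightKernel ρ ε) (ha : IsNormalizedBV a)
    (ha_bdd : IsLocallyBounded a) (hR : 0 ≤ R) (hs : 0 ≤ s) (hst : s ≤ t) {X : ℝ → ℝ}
    (hX : Continuous X) (l r : ℝ) :
    IntervalIntegrable (fun σ => avg ρ (localSpeed a R s t σ) (X σ)) volume l r := by
  obtain ⟨C, hC0, hC⟩ := exists_abs_localSpeed_le ha_bdd hR hs hst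
  exact intervalIntegrable_of_abs_le
    (measurable_comp_graph (measurable_avg_localSpeed h ha R s t) hX)
    (fun σ => h.abs_avg_le (locallyIntegrable_localSpeed ha ha_bdd hR hs hst σ) fun z _ => hC σ _)
    l r

/-- Averaging commutes with translations, so it preserves a one-sided Lipschitz bound with the same
constant, whatever `ε` is. -/
theorem avg_localSpeed_sub_le (h : IsRightKernel ρ ε) (ha : IsNormalizedBV a)
    (ha_bdd : IsLocallyBounded a) {E : ℝ} (hE : OleinikBound a E) (hR : 0 ≤ R) (hs : 0 < s)
    (hst : s ≤ t) (τ : ℝ) {x y : ℝ} (hxy : x ≤ y) :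
    avg ρ (localSpeed a R s t τ) y - avg ρ (localSpeed a R s t τ) x ≤
      max E 0 / s * (y - x) := by
  have hA := locallyIntegrable_localSpeed ha ha_bdd hR hs.le hst τ
  have h1 := h.avg_mono (x := y) (y := x) hA
    (hA.sub (locallyIntegrable_const (-(max E 0 / s * (y - x))))) fun z _ => by
      have := localSpeed_sub_le ha hE hs hst R τ (x := x + z) (y := y + z) (by linarith)
      rw [add_sub_add_right_eq_sub] at this
      simp only [Pi.sub_apply]
      linarith
  have h2 := h.avg_sub hA (locallyIntegrable_const (-(max E 0 / s * (y - x)))) x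
  rw [h.avg_const] at h2
  have h3 : avg ρ (localSpeed a R s t τ - fun _ => -(max E 0 / s * (y - x))) x =
    avg ρ (fun z => localSpeed a R s t τ z - -(max E 0 / s * (y - x))) x := rfl
  linarith

/-- Backwards in time, two trajectories of the smoothed speed separate up to a factor. -/
theorem IsTrajectory.sub_le_mul_exp (h : IsRightKernel ρ ε) (ha : IsNormalizedBV a)
    (ha_bdd : IsLocallyBounded a) {E : ℝ} (hE : OleinikBound a E) (hR : 0 ≤ R) (hs : 0 < s)
    (hst : s ≤ t) {X Y : ℝ → ℝ}
    (hX : IsTrajectory (fun τ => avg ρ (localSpeed a R s t τ)) t X)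
    (hY : IsTrajectory (fun τ => avg ρ (localSpeed a R s t τ)) t Y) (hXY : X t < Y t)
    {τ : ℝ} (hτ : τ ∈ Icc s t) :
    Y t - X t ≤ (Y τ - X τ) * Real.exp (max E 0 / s * (t - s)) := by
  have hK : 0 ≤ max E 0 / s := div_nonneg (le_max_right _ _) hs.le
  have hg := le_max_mul_exp_of_sub_le_integral (w := fun τ => Y τ - X τ) hK le_rfl hτ.2
    (hY.continuous.sub hX.continuous).continuousOn fun τ₁ τ₂ h₁ h₁₂ h₂ habove => by
      have e1 := hX.sub_eq τ₁ τ₂ (h₁₂.trans h₂) h₂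
      have e2 := hY.sub_eq τ₁ τ₂ (h₁₂.trans h₂) h₂
      have hiX := intervalIntegrable_avg_localSpeed h ha ha_bdd hR hs.le hst hX.continuous τ₁ τ₂
      have hiY := intervalIntegrable_avg_localSpeed h ha ha_bdd hR hs.le hst hY.continuous τ₁ τ₂
      have e3 : (Y τ₂ - X τ₂) - (Y τ₁ - X τ₁) = ∫ σ in τ₁..τ₂,
          (avg ρ (localSpeed a R s t σ) (Y σ) - avg ρ (localSpeed a R s t σ) (X σ)) := by
        rw [intervalIntegral.integral_sub hiY hiX, ← e1, ← e2]; ring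
      rw [e3]
      refine intervalIntegral.integral_mono_on_of_le_Ioo h₁₂ (hiY.sub hiX)
        (Continuous.intervalIntegrable
          (continuous_const.mul (hY.continuous.sub hX.continuous)) _ _) fun σ hσ => ?_
      exact avg_localSpeed_sub_le h ha ha_bdd hE hR hs hst σ
        (by linarith [habove σ (Ioo_subset_Ioc_self hσ)])
  have hpos : 0 < max (Y τ - X τ) 0 := by
    by_contra! hn
    have : max (Y τ - X τ) 0 * Real.exp (max E 0 / s * (t - τ)) ≤ 0 :=
      mul_nonpos_of_nonpos_of_nonneg hn (Real.exp_pos _).le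
    linarith
  have hw : 0 < Y τ - X τ := by
    rcases lt_max_iff.1 hpos with h | h
    · exact h
    · exact absurd h (lt_irrefl _)
  rw [max_eq_left hw.le] at hg
  refine hg.trans ?_
  gcongr
  exact hτ.1

theorem IsForwardGenChar.intervalIntegrable_deriv {x₀ : ℝ} {y : ℝ → ℝ}
    (hy : IsForwardGenChar a x₀ y) {l r : ℝ} (hl : 0 ≤ l) (hlr : l ≤ r) :
    IntervalIntegrable (deriv y) volume l r ∧ ∫ τ in l..r, deriv y τ = y r - y l := by
  have h1 := (hy.absolutelyContinuous (r + 1) (by linarith)).mono (c := l) (d := r) (by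
    rw [uIcc_of_le hlr, uIcc_of_le (by linarith)]
    exact Icc_subset_Icc hl (by linarith))
  exact ⟨h1.intervalIntegrable_deriv, h1.integral_deriv_eq_sub⟩

theorem IsForwardGenChar.continuousOn {x₀ : ℝ} {y : ℝ → ℝ} (hy : IsForwardGenChar a x₀ y) :
    ContinuousOn y (Ici 0) := fun τ hτ => by
  have h0 : (0 : ℝ) ≤ τ := hτ
  have h1 := (hy.absolutelyContinuous (τ + 1) (by linarith)).continuousOn
  rw [uIcc_of_le (by linarith)] at h1
  refine (h1 τ ⟨h0, by linarith⟩).mono_of_mem_nhdsWithin ?_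
  rw [← Ici_inter_Iic]
  exact inter_mem self_mem_nhdsWithin (mem_nhdsWithin_of_mem_nhds (Iic_mem_nhds (by linarith)))

/-- Trajectories of the smoothed speed do not cross a generalized characteristic from the right. -/
theorem IsForwardGenChar.lt_trajectory (h : IsRightKernel ρ ε) (ha : IsNormalizedBV a)
    (ha_bdd : IsLocallyBounded a) {E : ℝ} (hE : OleinikBound a E) (hR : 0 ≤ R) (hs : 0 < s)
    (hst : s ≤ t) {X ξ : ℝ → ℝ} {ξ₀ : ℝ}
    (hX : IsTrajectory (fun τ => avg ρ (localSpeed a R s t τ)) t X)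
    (hξ : IsForwardGenChar a ξ₀ ξ) (hξR : ∀ τ ∈ Icc s t, |ξ τ| ≤ R)
    (hε : ε * Real.exp (max E 0 / s * (t - s)) < X t - ξ t) {τ : ℝ} (hτ : τ ∈ Icc s t) :
    ξ τ < X τ := by
  by_contra! hn
  have hK : 0 ≤ max E 0 / s := div_nonneg (le_max_right _ _) hs.le
  have h0 := h.nonneg_width
  have hcξ : ContinuousOn ξ (Icc τ t) :=
    hξ.continuousOn.mono fun σ hσ => (hs.le.trans hτ.1).trans hσ.1
  have hcw : ContinuousOn (fun τ => X τ - ξ τ + ε) (Icc τ t) :=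
    (hX.continuous.continuousOn.sub hcξ).add continuousOn_const
  -- The average at `X` looks as far as `X + ε`, so the one-sided bound controls `X' - ξ'` by `K (X
  -- - ξ + ε)`. This quantity exceeds the threshold `ε` exactly when `X > ξ`.
  have hg := le_max_mul_exp_of_sub_le_integral (w := fun τ => X τ - ξ τ + ε) hK h0 hτ.2 hcw
    fun τ₁ τ₂ h₁ h₁₂ h₂ habove => by
      have hs₁ : s ≤ τ₁ := hτ.1.trans h₁
      have e1 := hX.sub_eq τ₁ τ₂ (h₁₂.trans h₂) h₂
      obtain ⟨hiξ, e2⟩ := hξ.intervalIntegrable_deriv (hs.le.trans hs₁) h₁₂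
      have hiX := intervalIntegrable_avg_localSpeed h ha ha_bdd hR hs.le hst hX.continuous τ₁ τ₂
      have e3 : (X τ₂ - ξ τ₂ + ε) - (X τ₁ - ξ τ₁ + ε) = ∫ σ in τ₁..τ₂,
          (avg ρ (localSpeed a R s t σ) (X σ) - deriv ξ σ) := by
        rw [intervalIntegral.integral_sub hiX hiξ, ← e1, e2]; ring
      rw [e3]
      have hiw : IntervalIntegrable (fun τ => max E 0 / s * (X τ - ξ τ + ε)) volume τ₁ τ₂ := by
        refine ContinuousOn.intervalIntegrable (continuousOn_const.mul (hcw.mono ?_))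
        rw [uIcc_of_le h₁₂]
        exact Icc_subset_Icc h₁ h₂
      rw [intervalIntegral.integral_of_le h₁₂, intervalIntegral.integral_of_le h₁₂]
      refine setIntegral_mono_ae_restrict (hiX.sub hiξ).1 hiw.1 ?_
      filter_upwards [ae_restrict_mem measurableSet_Ioc, ae_restrict_of_ae hξ.speed] with σ hσ hsp
      have hσs : σ ∈ Icc s t := ⟨hs₁.trans hσ.1.le, hσ.2.trans h₂⟩
      have hσ0 : 0 < σ := hs.trans_le hσs.1
      have hlt : ξ σ < X σ := by linarith [habove σ hσ]
      have hr := (hsp hσ0).1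
      -- Only the lower bound on `ξ'` is needed here, and by right-continuity it is the value of `a`
      -- on the curve.
      rw [(ha.rightContinuous σ hσ0.le (ξ σ)).rightLim_eq] at hr
      have hAξ : localSpeed a R s t σ (ξ σ) = a (ξ σ) σ := by
        rw [localSpeed, clamp_of_mem hσs, clamp_of_mem (abs_le.1 (hξR σ hσs))]
      have hb : avg ρ (localSpeed a R s t σ) (X σ) ≤
          localSpeed a R s t σ (ξ σ) + max E 0 / s * (X σ + ε - ξ σ) := by
        refine h.avg_le (locallyIntegrable_localSpeed ha ha_bdd hR hs.le hst σ) fun z hz => ?_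
        have := localSpeed_sub_le ha hE hs hst R σ (x := ξ σ) (y := X σ + z)
          (by linarith [hz.1])
        have h5 : max E 0 / s * (X σ + z - ξ σ) ≤ max E 0 / s * (X σ + ε - ξ σ) := by
          gcongr; exact hz.2
        linarith
      have h6 : X σ + ε - ξ σ = X σ - ξ σ + ε := by ring
      rw [h6] at hb
      linarith
  have h1 : max (X τ - ξ τ + ε) ε = ε := max_eq_right (by linarith)
  rw [h1] at hg
  have h2 : ε * Real.exp (max E 0 / s * (t - τ)) ≤ ε * Real.exp (max E 0 / s * (t - s)) := by
    gcongr; exact hτ.1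
  linarith

theorem leftLim_sub_le {f : ℝ → ℝ} {K : ℝ}
    (hf : ∀ x y, x ≤ y → f y - f x ≤ K * (y - x)) {x y : ℝ} (hxy : x < y) :
    Function.leftLim f y - f x ≤ K * (y - x) := by
  by_cases hl : ∃ l, Tendsto f (𝓝[<] y) (𝓝 l)
  · have h1 := tendsto_leftLim_of_tendsto hl
    have h2 : Tendsto (fun z => K * (z - x)) (𝓝[<] y) (𝓝 (K * (y - x))) := by
      apply tendsto_nhdsWithin_of_tendsto_nhds
      exact Continuous.tendsto (by fun_prop : Continuous fun z => K * (z - x)) y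
    refine le_of_tendsto_of_tendsto (h1.sub_const (f x)) h2 ?_
    filter_upwards [Ioo_mem_nhdsLT hxy] with z hz using hf x z hz.1.le
  -- Without a left limit, `Function.leftLim` takes the value of the function itself.
  · rw [leftLim_eq_of_not_tendsto f hl]
    exact hf x y hxy.le

/-- Trajectories of the smoothed speed do not cross a generalized characteristic from the left. -/
theorem IsForwardGenChar.trajectory_lt (h : IsRightKernel ρ ε) (ha : IsNormalizedBV a)
    (ha_bdd : IsLocallyBounded a) {E : ℝ} (hE : OleinikBound a E) (hR : 0 ≤ R) (hs : 0 < s)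
    (hst : s ≤ t) {X ζ : ℝ → ℝ} {ζ₀ : ℝ}
    (hX : IsTrajectory (fun τ => avg ρ (localSpeed a R s t τ)) t X)
    (hζ : IsForwardGenChar a ζ₀ ζ) (hζR : ∀ τ ∈ Icc s t, |ζ τ| ≤ R)
    (hXR : ∀ τ ∈ Icc s t, -R ≤ X τ)
    (hε : ε * Real.exp (max E 0 / s * (t - s)) < ζ t - X t) {τ : ℝ} (hτ : τ ∈ Icc s t) :
    X τ < ζ τ := by
  by_contra! hn
  have hK : 0 ≤ max E 0 / s := div_nonneg (le_max_right _ _) hs.le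
  have h0 := h.nonneg_width
  have hcζ : ContinuousOn ζ (Icc τ t) :=
    hζ.continuousOn.mono fun σ hσ => (hs.le.trans hτ.1).trans hσ.1
  have hcw : ContinuousOn (fun τ => ζ τ - X τ) (Icc τ t) :=
    hcζ.sub hX.continuous.continuousOn
  -- Above the threshold `ε` the whole averaging interval `[X, X + ε]` lies strictly to the left of
  -- `ζ`, so the speeds seen there can be compared with the left trace at `ζ`.
  have hg := le_max_mul_exp_of_sub_le_integral (w := fun τ => ζ τ - X τ) hK h0 hτ.2 hcw
    fun τ₁ τ₂ h₁ h₁₂ h₂ habove => by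
      have hs₁ : s ≤ τ₁ := hτ.1.trans h₁
      have e1 := hX.sub_eq τ₁ τ₂ (h₁₂.trans h₂) h₂
      obtain ⟨hiζ, e2⟩ := hζ.intervalIntegrable_deriv (hs.le.trans hs₁) h₁₂
      have hiX := intervalIntegrable_avg_localSpeed h ha ha_bdd hR hs.le hst hX.continuous τ₁ τ₂
      have e3 : (ζ τ₂ - X τ₂) - (ζ τ₁ - X τ₁) = ∫ σ in τ₁..τ₂,
          (deriv ζ σ - avg ρ (localSpeed a R s t σ) (X σ)) := by
        rw [intervalIntegral.integral_sub hiζ hiX, ← e1, e2]; ring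
      rw [e3]
      have hiw : IntervalIntegrable (fun τ => max E 0 / s * (ζ τ - X τ)) volume τ₁ τ₂ := by
        refine ContinuousOn.intervalIntegrable (continuousOn_const.mul (hcw.mono ?_))
        rw [uIcc_of_le h₁₂]
        exact Icc_subset_Icc h₁ h₂
      rw [intervalIntegral.integral_of_le h₁₂, intervalIntegral.integral_of_le h₁₂]
      refine setIntegral_mono_ae_restrict (hiζ.sub hiX).1 hiw.1 ?_
      filter_upwards [ae_restrict_mem measurableSet_Ioc, ae_restrict_of_ae hζ.speed] with σ hσ hsp
      have hσs : σ ∈ Icc s t := ⟨hs₁.trans hσ.1.le, hσ.2.trans h₂⟩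
      have hσ0 : 0 < σ := hs.trans_le hσs.1
      have hlt : ε < ζ σ - X σ := habove σ hσ
      have hl := (hsp hσ0).2
      have hb : Function.leftLim (fun x => a x σ) (ζ σ) - max E 0 / s * (ζ σ - X σ) ≤
          avg ρ (localSpeed a R s t σ) (X σ) := by
        refine h.le_avg (locallyIntegrable_localSpeed ha ha_bdd hR hs.le hst σ) fun z hz => ?_
        have hosl : ∀ x y, x ≤ y → a y σ - a x σ ≤ E / σ * (y - x) := fun x y hxy =>
          hE.sub_le hσ0 (ha.locallyIntegrable hσ0.le) (ha.rightContinuous _ hσ0.le) hxy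
        -- The left trace belongs to `a` itself and not to its extension, so the averaged points
        -- must lie where the two agree; hence the lower bound on `X`.
        have hzR : X σ + z ∈ Icc (-R) R := by
          have := (abs_le.1 (hζR σ hσs)).2
          exact ⟨by linarith [hXR σ hσs, hz.1], by linarith [hz.2]⟩
        have := leftLim_sub_le (f := fun x => a x σ) hosl (x := X σ + z) (y := ζ σ)
          (by linarith [hz.2])
        have hEs : E / σ ≤ max E 0 / s :=
          (div_le_div_of_nonneg_right (le_max_left E 0) hσ0.le).trans
            (div_le_div_of_nonneg_left (le_max_right _ _) hs hσs.1)
        have h5 : E / σ * (ζ σ - (X σ + z)) ≤ max E 0 / s * (ζ σ - X σ) :=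
          mul_le_mul hEs (by linarith [hz.1]) (by linarith [hz.2]) hK
        rw [localSpeed, clamp_of_mem hσs, clamp_of_mem hzR]
        linarith
      linarith
  have h1 : max (ζ τ - X τ) ε = ε := max_eq_right (by linarith)
  rw [h1] at hg
  have h2 : ε * Real.exp (max E 0 / s * (t - τ)) ≤ ε * Real.exp (max E 0 / s * (t - s)) := by
    gcongr; exact hτ.1
  linarith

end TransportBV

/-! ### Mass balance between two trajectories -/

namespace TransportBV

variable {a ψ : ℝ → ℝ → ℝ} {R s t : ℝ} {ρ : ℝ → ℝ} {ε : ℝ}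

/-- The commutator between averaging and multiplication by the speed. -/
noncomputable def commutator (ρ : ℝ → ℝ) (a ψ : ℝ → ℝ → ℝ) (R s t τ y : ℝ) : ℝ :=
  avg ρ (localSpeed a R s t τ) y * avg ρ (localDensity ψ R s t τ) y -
    avg ρ (fun z => localSpeed a R s t τ z * localDensity ψ R s t τ z) y

/-- Quadratically small increments force a zero derivative. A conservation law can thus be checked
up to second order on short time steps, without differentiating integrals with moving end points. -/
theorem eq_of_abs_sub_le_sq {F : ℝ → ℝ} {B : ℝ} (hst : s ≤ t)
    (h : ∀ τ₁ τ₂, s ≤ τ₁ → τ₁ ≤ τ₂ → τ₂ ≤ t → |F τ₂ - F τ₁| ≤ B * (τ₂ - τ₁) ^ 2) : F t = F s := by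
  set G : ℝ → ℝ := fun τ => F (clamp s t τ) with hG
  have hB : ∀ x y, |G y - G x| ≤ |B| * (y - x) ^ 2 := by
    have key : ∀ x y, x ≤ y → |G y - G x| ≤ |B| * (y - x) ^ 2 := fun x y hxy => by
      have h1 := h _ _ (clamp_mem hst x).1 (monotone_clamp s t hxy) (clamp_mem hst y).2
      refine h1.trans (mul_le_mul (le_abs_self B) ?_ (sq_nonneg _) (abs_nonneg _))
      have h2 := sub_nonneg.2 (monotone_clamp s t hxy)
      have h3 := clamp_sub_le (l := s) (r := t) hxy
      exact pow_le_pow_left₀ h2 h3 2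
    intro x y
    rcases le_total x y with hxy | hxy
    · exact key x y hxy
    · rw [abs_sub_comm, ← neg_sub x y, neg_sq]; exact key y x hxy
  have hd : ∀ x, HasDerivAt G 0 x := fun x => by
    rw [hasDerivAt_iff_isLittleO]
    have h1 : (fun y => G y - G x - (y - x) • (0 : ℝ)) =O[𝓝 x] fun y => (y - x) ^ 2 := by
      refine Asymptotics.IsBigO.of_bound |B| (Eventually.of_forall fun y => ?_)
      simpa using hB x y
    refine h1.trans_isLittleO ?_
    have h2 : (fun y : ℝ => y ^ 2) =o[𝓝 0] fun y => y := by
      simpa using Asymptotics.isLittleO_pow_pow (𝕜 := ℝ) (m := 1) (n := 2) (by norm_num)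
    have h3 : Tendsto (fun y => y - x) (𝓝 x) (𝓝 0) := by
      simpa using (continuous_id.sub continuous_const).tendsto (f := fun y => y - x) x
    exact h2.comp_tendsto h3
  have := is_const_of_deriv_eq_zero (fun x => (hd x).differentiableAt) (fun x => (hd x).deriv) t s
  simpa [hG, clamp_of_mem (l := s) (r := t) ⟨hst, le_rfl⟩,
    clamp_of_mem (l := s) (r := t) ⟨le_rfl, hst⟩] using this

theorem integrable_localFlux (ha : IsNormalizedBV a) (ha_bdd : IsLocallyBounded a)
    (hψ : IsNormalizedBV ψ) (hR : 0 ≤ R) (hs : 0 ≤ s) (hst : s ≤ t) (τ : ℝ) :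
    Integrable fun z => localSpeed a R s t τ z * localDensity ψ R s t τ z := by
  obtain ⟨C, -, hC⟩ := exists_abs_localSpeed_le ha_bdd hR hs hst
  exact (integrable_localDensity hψ hs hst R τ).bdd_mul (c := C)
    ((measurable_localSpeed ha R s t).comp measurable_prodMk_left).aestronglyMeasurable
    (Eventually.of_forall (hC τ))

theorem integral_abs_localFlux_le (ha : IsNormalizedBV a) (ha_bdd : IsLocallyBounded a)
    (hψ : IsNormalizedBV ψ) (hR : 0 ≤ R) (hs : 0 ≤ s) (hst : s ≤ t) {C M : ℝ} (hC0 : 0 ≤ C)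
    (hC : ∀ τ x, |localSpeed a R s t τ x| ≤ C) (hM : ∀ τ, ∫ x, |localDensity ψ R s t τ x| ≤ M)
    (τ : ℝ) : ∫ z, |localSpeed a R s t τ z * localDensity ψ R s t τ z| ≤ C * M := by
  calc ∫ z, |localSpeed a R s t τ z * localDensity ψ R s t τ z|
      ≤ ∫ z, C * |localDensity ψ R s t τ z| := by
        refine integral_mono (integrable_localFlux ha ha_bdd hψ hR hs hst τ).abs
          ((integrable_localDensity hψ hs hst R τ).abs.const_mul C) fun z => ?_
        simp only [abs_mul]
        exact mul_le_mul_of_nonneg_right (hC τ z) (abs_nonneg _)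
    _ = C * ∫ z, |localDensity ψ R s t τ z| := integral_const_mul _ _
    _ ≤ C * M := mul_le_mul_of_nonneg_left (hM τ) hC0

/-- The change in time of the averaged mass of an interval is given by the averaged fluxes. -/
theorem integral_avg_localDensity_sub (h : IsRightKernel ρ ε) (ha : IsNormalizedBV a)
    (ha_bdd : IsLocallyBounded a) (hψ : IsBVSolution a ψ) (hR : 0 ≤ R) (hs : 0 < s)
    {y₁ y₂ τ₁ τ₂ : ℝ} (hy₁ : -R ≤ y₁) (hy : y₁ ≤ y₂) (hy₂ : y₂ + ε ≤ R)
    (h₁ : s ≤ τ₁) (h₁₂ : τ₁ ≤ τ₂) (h₂ : τ₂ ≤ t) :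
    (∫ y in y₁..y₂, avg ρ (localDensity ψ R s t τ₂) y) -
      ∫ y in y₁..y₂, avg ρ (localDensity ψ R s t τ₁) y =
    ∫ σ in τ₁..τ₂, (avg ρ (fun z => localSpeed a R s t σ z * localDensity ψ R s t σ z) y₁ -
      avg ρ (fun z => localSpeed a R s t σ z * localDensity ψ R s t σ z) y₂) := by
  have hst : s ≤ t := h₁.trans (h₁₂.trans h₂)
  have hp := fun τ => (integrable_localDensity hψ.normalizedBV hs.le hst R τ).locallyIntegrable
  rw [← h.integral_mul_window (hp τ₂) hy, ← h.integral_mul_window (hp τ₁) hy,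
    hψ.integral_localDensity_sub ha ha_bdd hR hs (h.contDiff_window y₁ y₂)
      (fun x hx => h.window_eq_zero hy fun hx' => hx
        ⟨hy₁.trans hx'.1, hx'.2.trans hy₂⟩) h₁ h₁₂ h₂]
  refine intervalIntegral.integral_congr fun σ _ => ?_
  have hf := (integrable_localFlux ha ha_bdd hψ.normalizedBV hR hs.le hst σ).locallyIntegrable
  have hi : ∀ x, Integrable (fun z => ρ (z - x) *
      (localSpeed a R s t σ z * localDensity ψ R s t σ z)) := fun x => by
    have := (h.integrable_mul_comp_add hf x).comp_sub_right x
    simpa using this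
  simp only [IsRightKernel.avg_eq]
  rw [← integral_sub (hi y₁) (hi y₂), h.deriv_window]
  congr 1; ext z; ring

/-- Testing the equation with a translate of `ρ` puts the space derivative on the kernel. The
constant depends on `ρ`, which is harmless: it only enters second-order errors for a fixed kernel.
-/
theorem exists_abs_avg_localDensity_sub_le (h : IsRightKernel ρ ε) (ha : IsNormalizedBV a)
    (ha_bdd : IsLocallyBounded a) (hψ : IsBVSolution a ψ) (hR : 0 ≤ R) (hs : 0 < s)
    (hst : s ≤ t) :
    ∃ B, 0 ≤ B ∧ ∀ y, -R ≤ y → y + ε ≤ R → ∀ τ₁ τ₂, s ≤ τ₁ → τ₁ ≤ τ₂ → τ₂ ≤ t →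
      |avg ρ (localDensity ψ R s t τ₂) y - avg ρ (localDensity ψ R s t τ₁) y| ≤
        B * (τ₂ - τ₁) := by
  obtain ⟨c, hc⟩ := h.hasCompactSupport.deriv.exists_bound_of_continuous
    (h.contDiff.continuous_deriv (by simp))
  obtain ⟨B, hB⟩ := exists_abs_flux_le ha_bdd hψ hR hs.le hst c
  have hB0 : 0 ≤ B := (abs_nonneg _).trans (hB (deriv ρ) hc 0)
  refine ⟨B, hB0, fun y hy hy' τ₁ τ₂ h₁ h₁₂ h₂ => ?_⟩
  have h1 := hψ.integral_localDensity_sub ha ha_bdd hR hs (χ := fun z => ρ (z - y))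
    (by have := h.contDiff; fun_prop)
    (fun z hz => h.eq_zero _ fun hz' => hz ⟨by linarith [hz'.1], by linarith [hz'.2]⟩) h₁ h₁₂ h₂
  simp only [IsRightKernel.avg_eq, mul_comm (ρ _)]
  rw [h1, ← abs_of_nonneg (sub_nonneg.2 h₁₂)]
  refine abs_integral_le_of_abs_le (fun σ => hB _ (fun x => ?_) σ) _ _
  rw [deriv_comp_sub_const]
  exact hc _

theorem measurable_avg_localDensity (h : IsRightKernel ρ ε) (hψ : IsNormalizedBV ψ) (R s t : ℝ) :
    Measurable (Function.uncurry fun τ => avg ρ (localDensity ψ R s t τ)) :=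
  h.measurable_avg (measurable_localDensity hψ R s t)

theorem measurable_avg_localFlux (h : IsRightKernel ρ ε) (ha : IsNormalizedBV a)
    (hψ : IsNormalizedBV ψ) (R s t : ℝ) :
    Measurable (Function.uncurry fun τ =>
      avg ρ (fun z => localSpeed a R s t τ z * localDensity ψ R s t τ z)) :=
  h.measurable_avg (f := fun τ z => localSpeed a R s t τ z * localDensity ψ R s t τ z)
    ((measurable_localSpeed ha R s t).mul (measurable_localDensity hψ R s t))

theorem measurable_commutator (h : IsRightKernel ρ ε) (ha : IsNormalizedBV a)
    (hψ : IsNormalizedBV ψ) (R s t : ℝ) :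
    Measurable (Function.uncurry (commutator ρ a ψ R s t)) :=
  ((measurable_avg_localSpeed h ha R s t).mul (measurable_avg_localDensity h hψ R s t)).sub
    (measurable_avg_localFlux h ha hψ R s t)

/-- A pointwise bound from the `L¹` norm alone, which yields time-uniform bounds on the averaged
density and flux for a fixed kernel. -/
theorem IsRightKernel.exists_abs_avg_le (h : IsRightKernel ρ ε) :
    ∃ c : ℝ, 0 ≤ c ∧ ∀ f : ℝ → ℝ, Integrable f → ∀ y, |avg ρ f y| ≤ c * ∫ z, |f z| := by
  obtain ⟨c, hc⟩ := h.hasCompactSupport.exists_bound_of_continuous h.continuous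
  refine ⟨c, (norm_nonneg _).trans (hc 0), fun f hf y => ?_⟩
  rw [IsRightKernel.avg_eq, ← integral_const_mul, ← Real.norm_eq_abs]
  refine norm_integral_le_of_norm_le (hf.abs.const_mul c) (Eventually.of_forall fun z => ?_)
  rw [norm_mul]
  exact mul_le_mul_of_nonneg_right (hc _) (norm_nonneg _)

/-- The averaged mass between two trajectories of the averaged speed changes only through the
commutator. -/
theorem integral_avg_localDensity_trajectory (h : IsRightKernel ρ ε) (ha : IsNormalizedBV a)
    (ha_bdd : IsLocallyBounded a) (hψ : IsBVSolution a ψ) (hR : 0 ≤ R) (hs : 0 < s)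
    (hst : s ≤ t) {X Y : ℝ → ℝ}
    (hX : IsTrajectory (fun τ => avg ρ (localSpeed a R s t τ)) t X)
    (hY : IsTrajectory (fun τ => avg ρ (localSpeed a R s t τ)) t Y)
    (hXY : ∀ τ ∈ Icc s t, X τ ≤ Y τ) (hXR : ∀ τ ∈ Icc s t, -R ≤ X τ)
    (hYR : ∀ τ ∈ Icc s t, Y τ + ε ≤ R) :
    (∫ y in (X t)..(Y t), avg ρ (localDensity ψ R s t t) y) -
      ∫ y in (X s)..(Y s), avg ρ (localDensity ψ R s t s) y =
    (∫ τ in s..t, commutator ρ a ψ R s t τ (Y τ)) -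
      ∫ τ in s..t, commutator ρ a ψ R s t τ (X τ) := by
  obtain ⟨C, hC0, hC⟩ := exists_abs_localSpeed_le ha_bdd hR hs.le hst
  obtain ⟨M, hM⟩ := exists_integral_abs_localDensity_le hψ hR hs.le hst
  have hM0 : 0 ≤ M := (integral_nonneg fun _ => abs_nonneg _).trans (hM 0)
  obtain ⟨L, hL0, hL⟩ := h.exists_lipschitz
  obtain ⟨B, hB0, hB⟩ := exists_abs_avg_localDensity_sub_le h ha ha_bdd hψ hR hs hst
  obtain ⟨c, hc0, hc⟩ := h.exists_abs_avg_le
  set b := fun τ => avg ρ (localSpeed a R s t τ) with hb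
  set d := fun τ => avg ρ (localDensity ψ R s t τ) with hd
  set k := fun τ => avg ρ (fun z => localSpeed a R s t τ z * localDensity ψ R s t τ z) with hk
  have hpi := fun τ => integrable_localDensity hψ.normalizedBV hs.le hst R τ
  have hfi := fun τ => integrable_localFlux ha ha_bdd hψ.normalizedBV hR hs.le hst τ
  have hfM := fun τ => integral_abs_localFlux_le ha ha_bdd hψ.normalizedBV hR hs.le hst hC0 hC hM τ
  have hbC : ∀ τ y, |b τ y| ≤ C := fun τ y =>
    h.abs_avg_le (locallyIntegrable_localSpeed ha ha_bdd hR hs.le hst τ) fun z _ => hC τ _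
  have hdL : ∀ τ x y, |d τ x - d τ y| ≤ L * M * |x - y| := fun τ x y =>
    h.abs_avg_sub_le hL (hpi τ).locallyIntegrable x y (hpi τ) (hM τ) hL0
  have hkL : ∀ τ x y, |k τ x - k τ y| ≤ L * (C * M) * |x - y| := fun τ x y =>
    h.abs_avg_sub_le hL (hfi τ).locallyIntegrable x y (hfi τ) (hfM τ) hL0
  have hdc : ∀ τ y, |d τ y| ≤ c * M := fun τ y =>
    (hc _ (hpi τ) y).trans (mul_le_mul_of_nonneg_left (hM τ) hc0)
  have hkc : ∀ τ y, |k τ y| ≤ c * (C * M) := fun τ y =>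
    (hc _ (hfi τ) y).trans (mul_le_mul_of_nonneg_left (hfM τ) hc0)
  have hdcont : ∀ τ, Continuous (d τ) := fun τ => by
    refine (LipschitzWith.of_dist_le_mul (K := ⟨L * M, by positivity⟩) fun x y => ?_).continuous
    exact hdL τ x y
  have hbm := measurable_avg_localSpeed h ha R s t
  have hdm := measurable_avg_localDensity h hψ.normalizedBV R s t
  have hkm := measurable_avg_localFlux h ha hψ.normalizedBV R s t
  have hbi : ∀ Z : ℝ → ℝ, Continuous Z → ∀ l r, IntervalIntegrable (fun σ => b σ (Z σ)) volume l r :=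
    fun Z hZ => intervalIntegrable_of_abs_le (measurable_comp_graph hbm hZ) fun σ => hbC σ _
  have hki : ∀ Z : ℝ → ℝ, Continuous Z → ∀ l r, IntervalIntegrable (fun σ => k σ (Z σ)) volume l r :=
    fun Z hZ => intervalIntegrable_of_abs_le (measurable_comp_graph hkm hZ) fun σ => hkc σ _
  have hbdi : ∀ Z : ℝ → ℝ, Continuous Z → ∀ l r,
      IntervalIntegrable (fun σ => b σ (Z σ) * d σ (Z σ)) volume l r := fun Z hZ =>
    intervalIntegrable_of_abs_le (C := C * (c * M))
      ((measurable_comp_graph hbm hZ).mul (measurable_comp_graph hdm hZ)) fun σ => by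
        rw [abs_mul]
        exact mul_le_mul (hbC σ _) (hdc σ _) (abs_nonneg _) hC0
  have hcomm : ∀ Z : ℝ → ℝ, Continuous Z → ∀ l r,
      ∫ τ in l..r, commutator ρ a ψ R s t τ (Z τ) =
        (∫ τ in l..r, b τ (Z τ) * d τ (Z τ)) - ∫ τ in l..r, k τ (Z τ) := fun Z hZ l r => by
    rw [← intervalIntegral.integral_sub (hbdi Z hZ l r) (hki Z hZ l r)]
    rfl
  have hcommi : ∀ Z : ℝ → ℝ, Continuous Z → ∀ l r,
      IntervalIntegrable (fun τ => commutator ρ a ψ R s t τ (Z τ)) volume l r :=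
    fun Z hZ l r => (hbdi Z hZ l r).sub (hki Z hZ l r)
  have hspeed : ∀ Z, IsTrajectory b t Z → ∀ τ₁ τ₂, τ₁ ≤ τ₂ → τ₂ ≤ t → ∀ σ ∈ Icc τ₁ τ₂,
      |Z σ - Z τ₁| ≤ C * (τ₂ - τ₁) := fun Z hZ τ₁ τ₂ h₁₂ h₂ σ hσ => by
    rw [hZ.sub_eq τ₁ σ (h₁₂.trans h₂) (hσ.2.trans h₂)]
    refine (abs_integral_le_of_abs_le (fun σ => hbC σ _) _ _).trans ?_
    rw [abs_of_nonneg (sub_nonneg.2 hσ.1)]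
    exact mul_le_mul_of_nonneg_left (by linarith [hσ.2]) hC0
  -- The mass swept by a moving end point is the integral of `b d` along the curve up to second
  -- order: freeze `d` at `(Z τ₁, τ₂)`, where the swept length is `∫ b`, and unfreeze using the
  -- Lipschitz bounds in space and time.
  have hcurve : ∀ Z, IsTrajectory b t Z → (∀ τ ∈ Icc s t, -R ≤ Z τ) →
      (∀ τ ∈ Icc s t, Z τ + ε ≤ R) → ∀ τ₁ τ₂, s ≤ τ₁ → τ₁ ≤ τ₂ → τ₂ ≤ t →
      |(∫ y in (Z τ₁)..(Z τ₂), d τ₂ y) - ∫ σ in τ₁..τ₂, b σ (Z σ) * d σ (Z σ)| ≤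
        (L * M * C ^ 2 + C * (L * M * C + B)) * (τ₂ - τ₁) ^ 2 := by
    intro Z hZ hZR hZR' τ₁ τ₂ h₁ h₁₂ h₂
    have hsp := hspeed Z hZ τ₁ τ₂ h₁₂ h₂
    have hdiff : 0 ≤ τ₂ - τ₁ := sub_nonneg.2 h₁₂
    have e1 : |(∫ y in (Z τ₁)..(Z τ₂), d τ₂ y) - ∫ y in (Z τ₁)..(Z τ₂), d τ₂ (Z τ₁)| ≤
        L * M * C ^ 2 * (τ₂ - τ₁) ^ 2 := by
      rw [← intervalIntegral.integral_sub ((hdcont τ₂).intervalIntegrable _ _)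
        intervalIntegrable_const, ← Real.norm_eq_abs]
      have hZ12 := hsp τ₂ ⟨h₁₂, le_rfl⟩
      refine (intervalIntegral.norm_integral_le_of_norm_le_const
        (C := L * M * (C * (τ₂ - τ₁))) fun y hy => ?_).trans ?_
      · refine (hdL τ₂ y (Z τ₁)).trans ?_
        gcongr
        have hy' := abs_sub_left_of_mem_uIcc (uIoc_subset_uIcc hy)
        exact hy'.trans hZ12
      · calc L * M * (C * (τ₂ - τ₁)) * |Z τ₂ - Z τ₁|
            ≤ L * M * (C * (τ₂ - τ₁)) * (C * (τ₂ - τ₁)) := by gcongr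
          _ = L * M * C ^ 2 * (τ₂ - τ₁) ^ 2 := by ring
    have e2 : ∫ y in (Z τ₁)..(Z τ₂), d τ₂ (Z τ₁) = ∫ σ in τ₁..τ₂, b σ (Z σ) * d τ₂ (Z τ₁) := by
      rw [intervalIntegral.integral_const, intervalIntegral.integral_mul_const,
        ← hZ.sub_eq τ₁ τ₂ (h₁₂.trans h₂) h₂, smul_eq_mul]
    have e3 : |(∫ σ in τ₁..τ₂, b σ (Z σ) * d τ₂ (Z τ₁)) -
        ∫ σ in τ₁..τ₂, b σ (Z σ) * d σ (Z σ)| ≤ C * (L * M * C + B) * (τ₂ - τ₁) ^ 2 := by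
      rw [← intervalIntegral.integral_sub ((hbi Z hZ.continuous _ _).mul_const _)
        (hbdi Z hZ.continuous _ _), ← Real.norm_eq_abs]
      refine (intervalIntegral.norm_integral_le_of_norm_le_const
        (C := C * (L * M * (C * (τ₂ - τ₁)) + B * (τ₂ - τ₁))) fun σ hσ => ?_).trans_eq ?_
      · rw [uIoc_of_le h₁₂] at hσ
        have hσs : σ ∈ Icc s t := ⟨h₁.trans hσ.1.le, hσ.2.trans h₂⟩
        rw [← mul_sub, norm_mul]
        refine mul_le_mul (hbC σ _) ?_ (norm_nonneg _) hC0
        have f1 : |d τ₂ (Z τ₁) - d τ₂ (Z σ)| ≤ L * M * (C * (τ₂ - τ₁)) := by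
          refine (hdL τ₂ _ _).trans ?_
          rw [abs_sub_comm]
          have := hsp σ ⟨hσ.1.le, hσ.2⟩
          gcongr
        have f2 : |d τ₂ (Z σ) - d σ (Z σ)| ≤ B * (τ₂ - τ₁) := by
          refine (hB (Z σ) (hZR σ hσs) (hZR' σ hσs) σ τ₂ hσs.1 hσ.2 h₂).trans ?_
          have := hσ.1.le
          gcongr
        rw [Real.norm_eq_abs]
        exact (abs_sub_le _ (d τ₂ (Z σ)) _).trans (add_le_add f1 f2)
      · rw [abs_of_nonneg hdiff]; ring
    rw [e2] at e1
    refine (abs_sub_le _ _ _).trans ((add_le_add e1 e3).trans_eq ?_)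
    ring
  have hflux : ∀ Z, IsTrajectory b t Z → ∀ τ₁ τ₂, τ₁ ≤ τ₂ → τ₂ ≤ t →
      |(∫ σ in τ₁..τ₂, k σ (Z τ₁)) - ∫ σ in τ₁..τ₂, k σ (Z σ)| ≤
        L * (C * M) * C * (τ₂ - τ₁) ^ 2 := by
    intro Z hZ τ₁ τ₂ h₁₂ h₂
    rw [← intervalIntegral.integral_sub (hki _ continuous_const _ _) (hki Z hZ.continuous _ _),
      ← Real.norm_eq_abs]
    refine (intervalIntegral.norm_integral_le_of_norm_le_const
      (C := L * (C * M) * (C * (τ₂ - τ₁))) fun σ hσ => ?_).trans_eq ?_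
    · rw [uIoc_of_le h₁₂] at hσ
      refine (hkL σ _ _).trans ?_
      rw [abs_sub_comm]
      have := hspeed Z hZ τ₁ τ₂ h₁₂ h₂ σ ⟨hσ.1.le, hσ.2⟩
      gcongr
    · rw [abs_of_nonneg (sub_nonneg.2 h₁₂)]; ring
  have hXε : ∀ τ ∈ Icc s t, X τ + ε ≤ R := fun τ hτ => by linarith [hXY τ hτ, hYR τ hτ]
  have hYR' : ∀ τ ∈ Icc s t, -R ≤ Y τ := fun τ hτ => (hXR τ hτ).trans (hXY τ hτ)
  -- Over a short step, the change with fixed end points gives the fluxes `k`, and the motion of the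
  -- end points gives `b d`. Their difference at each end is the commutator, up to second order.
  have key := eq_of_abs_sub_le_sq (F := fun τ => (∫ y in (X τ)..(Y τ), d τ y) -
      ((∫ σ in s..τ, commutator ρ a ψ R s t σ (Y σ)) -
        ∫ σ in s..τ, commutator ρ a ψ R s t σ (X σ)))
    (B := 2 * (L * M * C ^ 2 + C * (L * M * C + B)) + 2 * (L * (C * M) * C)) hst
    fun τ₁ τ₂ h₁ h₁₂ h₂ => by
      have hτ₁ : τ₁ ∈ Icc s t := ⟨h₁, h₁₂.trans h₂⟩
      have g1 := integral_avg_localDensity_sub h ha ha_bdd hψ hR hs (hXR τ₁ hτ₁) (hXY τ₁ hτ₁)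
        (hYR τ₁ hτ₁) h₁ h₁₂ h₂
      have g1' : (∫ y in (X τ₁)..(Y τ₁), d τ₂ y) - ∫ y in (X τ₁)..(Y τ₁), d τ₁ y =
          (∫ σ in τ₁..τ₂, k σ (X τ₁)) - ∫ σ in τ₁..τ₂, k σ (Y τ₁) := by
        rw [← intervalIntegral.integral_sub (hki _ continuous_const _ _)
          (hki _ continuous_const _ _)]
        exact g1
      have hdi : ∀ l r, IntervalIntegrable (d τ₂) volume l r := (hdcont τ₂).intervalIntegrable
      have g2 : ∫ y in (X τ₂)..(Y τ₂), d τ₂ y = (∫ y in (X τ₁)..(Y τ₁), d τ₂ y) +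
          (∫ y in (Y τ₁)..(Y τ₂), d τ₂ y) - ∫ y in (X τ₁)..(X τ₂), d τ₂ y := by
        rw [intervalIntegral.integral_add_adjacent_intervals (hdi _ _) (hdi _ _),
          ← intervalIntegral.integral_add_adjacent_intervals (hdi (X τ₁) (X τ₂)) (hdi _ (Y τ₂))]
        ring
      have g3 : ∀ Z : ℝ → ℝ, Continuous Z →
          (∫ σ in s..τ₂, commutator ρ a ψ R s t σ (Z σ)) -
            ∫ σ in s..τ₁, commutator ρ a ψ R s t σ (Z σ) =
          (∫ σ in τ₁..τ₂, b σ (Z σ) * d σ (Z σ)) - ∫ σ in τ₁..τ₂, k σ (Z σ) := fun Z hZ => by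
        rw [← hcomm Z hZ, intervalIntegral.integral_interval_sub_left (hcommi Z hZ _ _)
          (hcommi Z hZ _ _)]
      have g3X := g3 X hX.continuous
      have g3Y := g3 Y hY.continuous
      have cX := abs_le.1 (hcurve X hX hXR hXε τ₁ τ₂ h₁ h₁₂ h₂)
      have cY := abs_le.1 (hcurve Y hY hYR' hYR τ₁ τ₂ h₁ h₁₂ h₂)
      have fX := abs_le.1 (hflux X hX τ₁ τ₂ h₁₂ h₂)
      have fY := abs_le.1 (hflux Y hY τ₁ τ₂ h₁₂ h₂)
      rw [abs_le]
      constructor <;> nlinarith only [g1', g2, g3X, g3Y, cX, cY, fX, fY]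
  simp only [intervalIntegral.integral_same] at key
  linarith

end TransportBV

/-! ### Smallness of the commutator -/

namespace TransportBV

variable {a ψ : ℝ → ℝ → ℝ} {R s t : ℝ} {ρ : ℝ → ℝ} {ε : ℝ}

/-- Lebesgue measure on the line is one-dimensional Hausdorff measure, so preimages under `g` grow
by a factor of at most `Λ`. This is the bound on the density of the image measure. -/
theorem lintegral_comp_le_of_antilipschitz {Λ : NNReal} {g : ℝ → ℝ} (hg : AntilipschitzWith Λ g)
    (hgm : Measurable g) {f : ℝ → ENNReal} (hf : Measurable f) :
    ∫⁻ x, f (g x) ≤ Λ * ∫⁻ y, f y := by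
  have hle : Measure.map g volume ≤ (Λ : ENNReal) • (volume : Measure ℝ) := by
    refine Measure.le_iff.2 fun S hS => ?_
    rw [Measure.map_apply hgm hS, Measure.smul_apply, smul_eq_mul]
    have := hg.hausdorffMeasure_preimage_le zero_le_one S
    simpa [hausdorffMeasure_real] using this
  calc ∫⁻ x, f (g x) = ∫⁻ y, f y ∂(Measure.map g volume) := (lintegral_map hf hgm).symm
    _ ≤ ∫⁻ y, f y ∂((Λ : ENNReal) • (volume : Measure ℝ)) := lintegral_mono' hle le_rfl
    _ = Λ * ∫⁻ y, f y := by rw [lintegral_smul_measure, smul_eq_mul]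

theorem IsRightKernel.avg_eq_zero (h : IsRightKernel ρ ε) {f : ℝ → ℝ} {y : ℝ}
    (hf : ∀ z ∈ Icc 0 ε, f (y + z) = 0) : avg ρ f y = 0 := by
  rw [avg, integral_eq_zero_of_ae (Eventually.of_forall fun z => ?_)]
  by_cases hz : z ∈ Icc 0 ε
  · simp [hf z hz]
  · simp [h.eq_zero z hz]

/-- An average looking to the right enlarges the support only on the left, by at most `ε ≤ 1`, which
gives a dominating function independent of the kernel. -/
theorem IsRightKernel.abs_avg_le_indicator (h : IsRightKernel ρ ε) (hε : ε ≤ 1) {f : ℝ → ℝ}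
    (hf : LocallyIntegrable f) {c : ℝ} (hc : ∀ x, |f x| ≤ c) (h0 : ∀ x, x ∉ Icc (-R) R → f x = 0)
    (y : ℝ) : |avg ρ f y| ≤ (Icc (-R - 1) R).indicator (fun _ => c) y := by
  by_cases hy : y ∈ Icc (-R - 1) R
  · rw [indicator_of_mem hy]
    exact h.abs_avg_le hf fun z _ => hc _
  · rw [indicator_of_notMem hy, h.avg_eq_zero fun z hz => h0 _ fun hz' => hy
      ⟨by linarith [hz'.1, hz.2], by linarith [hz'.2, hz.1]⟩, abs_zero]

theorem localDensity_eq_zero {τ x : ℝ} (hx : x ∉ Icc (-R) R) : localDensity ψ R s t τ x = 0 :=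
  indicator_of_notMem hx _

theorem localDensity_eq {τ x : ℝ} (hx : x ∈ Icc (-R) R) (hτ : τ ∈ Icc s t) :
    localDensity ψ R s t τ x = ψ x τ := by
  rw [localDensity, indicator_of_mem hx, clamp_of_mem hτ]

theorem ae_tendsto_avg {ρ : ℕ → ℝ → ℝ} {ε : ℕ → ℝ} (h : ∀ n, IsRightKernel (ρ n) (ε n))
    (hε : Tendsto ε atTop (𝓝 0)) {f : ℝ → ℝ} (hf : LocallyIntegrable f)
    (hc : ∀ x, x ≠ R → x ≠ -R → ContinuousWithinAt f (Ici x) x) :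
    ∀ᵐ y, Tendsto (fun n => avg (ρ n) f y) atTop (𝓝 (f y)) := by
  filter_upwards [compl_mem_ae_iff.2 (measure_singleton R),
    compl_mem_ae_iff.2 (measure_singleton (-R))] with y h1 h2
  exact IsRightKernel.tendsto_avg h hε hf (hc y h1 h2)

theorem tendsto_integral_abs_avg_localDensity_sub {ρ : ℕ → ℝ → ℝ} {ε : ℕ → ℝ}
    (h : ∀ n, IsRightKernel (ρ n) (ε n)) (hε : Tendsto ε atTop (𝓝 0)) (hψ : IsNormalizedBV ψ)
    (hs : 0 ≤ s) (hst : s ≤ t) (R τ : ℝ) :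
    Tendsto (fun n => ∫ y, |avg (ρ n) (localDensity ψ R s t τ) y - localDensity ψ R s t τ y|)
      atTop (𝓝 0) := by
  obtain ⟨c, hc⟩ := exists_abs_localDensity_le hψ hs hst R τ
  have hp := integrable_localDensity hψ hs hst R τ
  have hpm : Measurable (localDensity ψ R s t τ) :=
    (measurable_localDensity hψ R s t).comp measurable_prodMk_left
  have key := tendsto_integral_filter_of_dominated_convergence (μ := volume) (l := atTop)
    (F := fun n y => |avg (ρ n) (localDensity ψ R s t τ) y - localDensity ψ R s t τ y|)
    (f := fun _ => (0 : ℝ))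
    (fun y => (Icc (-R - 1) R).indicator (fun _ => c) y + |localDensity ψ R s t τ y|)
    (Eventually.of_forall fun n => by
      have := ((measurable_avg_localDensity (h n) hψ R s t).comp
        (measurable_prodMk_left (x := τ))).sub hpm
      exact this.abs.aestronglyMeasurable)
    (by
      filter_upwards [hε.eventually (gt_mem_nhds one_pos)] with n hn
      refine Eventually.of_forall fun y => ?_
      rw [Real.norm_eq_abs, abs_abs]
      exact (abs_sub _ _).trans (add_le_add_left ((h n).abs_avg_le_indicator hn.le
        hp.locallyIntegrable hc (fun x hx => localDensity_eq_zero hx) y) _))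
    (((integrable_indicator_iff measurableSet_Icc).2 (integrableOn_const (by simp))).add hp.abs)
    (by
      filter_upwards [ae_tendsto_avg h hε hp.locallyIntegrable fun x hx hx' =>
        continuousWithinAt_localDensity hψ hs hst R τ hx hx'] with y hy
      simpa using (hy.sub_const (localDensity ψ R s t τ y)).abs)
  simpa using key

theorem abs_commutator_le (h : IsRightKernel ρ ε) (ha : IsNormalizedBV a)
    (ha_bdd : IsLocallyBounded a) (hψ : IsNormalizedBV ψ) (hR : 0 ≤ R) (hs : 0 ≤ s) (hst : s ≤ t)
    {C : ℝ} (hC : ∀ τ x, |localSpeed a R s t τ x| ≤ C) (τ y : ℝ) :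
    |commutator ρ a ψ R s t τ y| ≤ 2 * C * avg ρ (fun z => |localDensity ψ R s t τ z|) y := by
  have hC0 : 0 ≤ C := (abs_nonneg _).trans (hC 0 0)
  have hp := (integrable_localDensity hψ hs hst R τ)
  have hf := (integrable_localFlux ha ha_bdd hψ hR hs hst τ)
  have h1 : |avg ρ (localSpeed a R s t τ) y * avg ρ (localDensity ψ R s t τ) y| ≤
      C * avg ρ (fun z => |localDensity ψ R s t τ z|) y := by
    rw [abs_mul]
    exact mul_le_mul (h.abs_avg_le (locallyIntegrable_localSpeed ha ha_bdd hR hs hst τ)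
      fun z _ => hC τ _) (h.abs_avg_le_avg_abs _ y) (abs_nonneg _) hC0
  have h2 : |avg ρ (fun z => localSpeed a R s t τ z * localDensity ψ R s t τ z) y| ≤
      C * avg ρ (fun z => |localDensity ψ R s t τ z|) y := by
    refine (h.abs_avg_le_avg_abs _ y).trans ?_
    refine (h.avg_mono (y := y) (g := fun z => C * |localDensity ψ R s t τ z|)
      hf.abs.locallyIntegrable (hp.abs.const_mul C).locallyIntegrable fun z _ => ?_).trans_eq ?_
    · rw [abs_mul]
      exact mul_le_mul_of_nonneg_right (hC τ _) (abs_nonneg _)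
    · simp only [avg]
      rw [← integral_const_mul]
      congr 1; ext z; ring
  refine (abs_sub _ _).trans ((add_le_add h1 h2).trans_eq ?_)
  ring

/-- At fixed time, right-continuity of both factors gives `avg a * avg ψ - avg (a ψ) → 0` at every
point except possibly `±R`. Domination is in two stages: in space by a bound on `ψ(·,τ)` that
depends on `τ`, then in time by `2 C M` from the `L¹` norm. -/
theorem tendsto_lintegral_commutator {ρ : ℕ → ℝ → ℝ} {ε : ℕ → ℝ}
    (h : ∀ n, IsRightKernel (ρ n) (ε n)) (hε : Tendsto ε atTop (𝓝 0)) (ha : IsNormalizedBV a)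
    (ha_bdd : IsLocallyBounded a) (hψ : IsBVSolution a ψ) (hR : 0 ≤ R) (hs : 0 ≤ s)
    (hst : s ≤ t) :
    Tendsto (fun n => ∫⁻ τ in Icc s t, ∫⁻ y, ‖commutator (ρ n) a ψ R s t τ y‖ₑ)
      atTop (𝓝 0) := by
  obtain ⟨C, hC0, hC⟩ := exists_abs_localSpeed_le ha_bdd hR hs hst
  obtain ⟨M, hM⟩ := exists_integral_abs_localDensity_le hψ hR hs hst
  have hcm := fun n => measurable_commutator (h n) ha hψ.normalizedBV R s t
  have hbd := fun n τ y => abs_commutator_le (h n) ha ha_bdd hψ.normalizedBV hR hs hst hC τ y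
  have hpi := fun τ => integrable_localDensity hψ.normalizedBV hs hst R τ
  have hinner : ∀ τ, Tendsto (fun n => ∫⁻ y, ‖commutator (ρ n) a ψ R s t τ y‖ₑ) atTop (𝓝 0) := by
    intro τ
    obtain ⟨c, hc⟩ := exists_abs_localDensity_le hψ.normalizedBV hs hst R τ
    have key := tendsto_lintegral_filter_of_dominated_convergence (μ := volume) (l := atTop)
      (F := fun n y => ‖commutator (ρ n) a ψ R s t τ y‖ₑ) (f := fun _ => 0)
      (fun y => ENNReal.ofReal (2 * C * (Icc (-R - 1) R).indicator (fun _ => c) y))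
      (Eventually.of_forall fun n => ((hcm n).comp measurable_prodMk_left).enorm)
      (by
        filter_upwards [hε.eventually (gt_mem_nhds one_pos)] with n hn
        refine Eventually.of_forall fun y => ?_
        rw [Real.enorm_eq_ofReal_abs]
        refine ENNReal.ofReal_le_ofReal ((hbd n τ y).trans ?_)
        gcongr
        exact (le_abs_self _).trans ((h n).abs_avg_le_indicator hn.le
          (hpi τ).abs.locallyIntegrable (fun x => by rw [abs_abs]; exact hc x)
          (fun x hx => by rw [localDensity_eq_zero hx, abs_zero]) y))
      (by
        have hI : Integrable fun y => 2 * C * (Icc (-R - 1) R).indicator (fun _ => c) y :=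
          ((integrable_indicator_iff measurableSet_Icc).2
            (integrableOn_const (by simp))).const_mul _
        exact (hasFiniteIntegral_iff_ofReal (Eventually.of_forall fun y =>
          mul_nonneg (by positivity) (indicator_nonneg
            (fun _ _ => (abs_nonneg _).trans (hc 0)) y))).1 hI.2 |>.ne)
      (by
        filter_upwards [ae_tendsto_avg h hε (hpi τ).locallyIntegrable fun x hx hx' =>
            continuousWithinAt_localDensity hψ.normalizedBV hs hst R τ hx hx',
          ae_tendsto_avg h hε (integrable_localFlux ha ha_bdd hψ.normalizedBV hR hs hst
            τ).locallyIntegrable fun x hx hx' =>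
            (continuousWithinAt_localSpeed ha hs hst R τ x).mul
              (continuousWithinAt_localDensity hψ.normalizedBV hs hst R τ hx hx')] with y h1 h2
        have h3 := IsRightKernel.tendsto_avg h hε
          (locallyIntegrable_localSpeed ha ha_bdd hR hs hst τ)
          (continuousWithinAt_localSpeed ha hs hst R τ y)
        have h4 := ((h3.mul h1).sub h2).enorm
        simpa [commutator] using h4)
    simpa using key
  have key := tendsto_lintegral_filter_of_dominated_convergence (μ := volume.restrict (Icc s t))
    (l := atTop) (F := fun n τ => ∫⁻ y, ‖commutator (ρ n) a ψ R s t τ y‖ₑ) (f := fun _ => 0)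
    (fun _ => ENNReal.ofReal (2 * C * M))
    (Eventually.of_forall fun n => (hcm n).enorm.lintegral_prod_right')
    (Eventually.of_forall fun n => Eventually.of_forall fun τ => by
      obtain ⟨hi, he⟩ := (h n).integrable_avg (hpi τ).abs
      have hnn : ∀ y, 0 ≤ 2 * C * avg (ρ n) (fun z => |localDensity ψ R s t τ z|) y := fun y =>
        (abs_nonneg _).trans (hbd n τ y)
      calc ∫⁻ y, ‖commutator (ρ n) a ψ R s t τ y‖ₑ
          ≤ ∫⁻ y, ENNReal.ofReal (2 * C * avg (ρ n) (fun z => |localDensity ψ R s t τ z|) y) := by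
            refine lintegral_mono fun y => ?_
            rw [Real.enorm_eq_ofReal_abs]
            exact ENNReal.ofReal_le_ofReal (hbd n τ y)
        _ = ENNReal.ofReal (∫ y, 2 * C * avg (ρ n) (fun z => |localDensity ψ R s t τ z|) y) :=
            (ofReal_integral_eq_lintegral_ofReal (hi.const_mul _)
              (Eventually.of_forall hnn)).symm
        _ ≤ ENNReal.ofReal (2 * C * M) := by
            refine ENNReal.ofReal_le_ofReal ?_
            rw [integral_const_mul, he]
            exact mul_le_mul_of_nonneg_left (hM τ) (by positivity))
    (by
      rw [lintegral_const]
      exact ENNReal.mul_ne_top ENNReal.ofReal_ne_top (by simp))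
    (Eventually.of_forall fun τ => hinner τ)
  simpa using key

/-- In every interval some trajectory sees a small commutator. -/
theorem exists_small_commutator (h : IsRightKernel ρ ε) (ha : IsNormalizedBV a)
    (ha_bdd : IsLocallyBounded a) {E : ℝ} (hE : OleinikBound a E) (hψ : IsNormalizedBV ψ)
    (hR : 0 ≤ R) (hs : 0 < s) (hst : s ≤ t) {X : ℝ → ℝ → ℝ}
    (hX : ∀ x, IsTrajectory (fun τ => avg ρ (localSpeed a R s t τ)) t (X x))
    (hXt : ∀ x, X x t = x) (x₀ : ℝ) {δ η : ℝ}
    (hsmall : ENNReal.ofReal (Real.exp (max E 0 / s * (t - s))) *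
      (∫⁻ τ in Icc s t, ∫⁻ y, ‖commutator ρ a ψ R s t τ y‖ₑ) <
        ENNReal.ofReal η * ENNReal.ofReal δ) :
    ∃ x ∈ Icc x₀ (x₀ + δ), |∫ τ in s..t, commutator ρ a ψ R s t τ (X x τ)| ≤ η := by
  by_contra! hcon
  set Λ : NNReal := ⟨Real.exp (max E 0 / s * (t - s)), (Real.exp_pos _).le⟩ with hΛ
  have hexp : ∀ τ ∈ Icc s t, ∀ x y, x < y →
      y - x ≤ (X y τ - X x τ) * Real.exp (max E 0 / s * (t - s)) := fun τ hτ x y hxy => by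
    have := (hX x).sub_le_mul_exp h ha ha_bdd hE hR hs hst (hX y) (by rwa [hXt, hXt]) hτ
    rwa [hXt, hXt] at this
  have hmono : ∀ τ ∈ Icc s t, StrictMono fun x => X x τ := fun τ hτ x y hxy => by
    have h1 := hexp τ hτ x y hxy
    have h2 : 0 < X y τ - X x τ := by
      by_contra! hn
      have := mul_nonpos_of_nonpos_of_nonneg hn (Real.exp_pos (max E 0 / s * (t - s))).le
      linarith
    simpa using h2
  have hanti : ∀ τ ∈ Icc s t, AntilipschitzWith Λ fun x => X x τ := fun τ hτ => by
    refine AntilipschitzWith.of_le_mul_dist fun x y => ?_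
    have key : ∀ x y, x < y → dist x y ≤ Λ * dist (X x τ) (X y τ) := fun x y hxy => by
      have h1 := hmono τ hτ hxy
      rw [dist_comm, Real.dist_eq, dist_comm, Real.dist_eq, abs_of_pos (sub_pos.2 hxy),
        abs_of_pos (sub_pos.2 h1), mul_comm]
      exact hexp τ hτ x y hxy
    rcases lt_trichotomy x y with hxy | hxy | hxy
    · exact key x y hxy
    · simp [hxy]
    · rw [dist_comm, dist_comm (X x τ)]; exact key y x hxy
  have hcm := measurable_commutator h ha hψ R s t
  -- Joint measurability of the flow: continuous in time, and monotone in the end point because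
  -- trajectories are ordered.
  have hXm : Measurable fun q : ℝ × ℝ => X q.2 (clamp s t q.1) :=
    measurable_uncurry_of_continuous_of_measurable (u := fun τ x => X x (clamp s t τ))
      (fun x => (hX x).continuous.comp (continuous_clamp s t))
      (fun τ => (hmono _ (clamp_mem hst τ)).monotone.measurable)
  have hgm : Measurable fun q : ℝ × ℝ =>
      ‖commutator ρ a ψ R s t q.1 (X q.2 (clamp s t q.1))‖ₑ :=
    (hcm.comp (measurable_fst.prodMk hXm)).enorm
  have h1 : ∀ x ∈ Icc x₀ (x₀ + δ), ENNReal.ofReal η ≤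
      ∫⁻ τ in Icc s t, ‖commutator ρ a ψ R s t τ (X x (clamp s t τ))‖ₑ := fun x hx => by
    calc ENNReal.ofReal η ≤ ‖∫ τ in s..t, commutator ρ a ψ R s t τ (X x τ)‖ₑ := by
          rw [Real.enorm_eq_ofReal_abs]
          exact ENNReal.ofReal_le_ofReal (hcon x hx).le
      _ ≤ ∫⁻ τ in Icc s t, ‖commutator ρ a ψ R s t τ (X x τ)‖ₑ := by
          rw [intervalIntegral.integral_of_le hst, ← integral_Icc_eq_integral_Ioc]
          exact enorm_integral_le_lintegral_enorm _
      _ = _ := setLIntegral_congr_fun measurableSet_Icc fun τ hτ => by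
          simp only [clamp_of_mem hτ]
  -- Chebyshev: if every end point in the interval were bad, the double integral along trajectories
  -- would be at least `η δ`. Tonelli and the density bound estimate it by `Λ` times the norm of the
  -- commutator.
  have h2 : ENNReal.ofReal η * ENNReal.ofReal δ ≤
      ∫⁻ x, ∫⁻ τ in Icc s t, ‖commutator ρ a ψ R s t τ (X x (clamp s t τ))‖ₑ := by
    calc ENNReal.ofReal η * ENNReal.ofReal δ = ∫⁻ _ in Icc x₀ (x₀ + δ), ENNReal.ofReal η := by
          rw [setLIntegral_const, Real.volume_Icc, add_sub_cancel_left]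
      _ ≤ ∫⁻ x in Icc x₀ (x₀ + δ),
          ∫⁻ τ in Icc s t, ‖commutator ρ a ψ R s t τ (X x (clamp s t τ))‖ₑ :=
          setLIntegral_mono' measurableSet_Icc h1
      _ ≤ _ := setLIntegral_le_lintegral _ _
  have h3 : ∫⁻ x, ∫⁻ τ in Icc s t, ‖commutator ρ a ψ R s t τ (X x (clamp s t τ))‖ₑ =
      ∫⁻ τ in Icc s t, ∫⁻ x, ‖commutator ρ a ψ R s t τ (X x (clamp s t τ))‖ₑ :=
    lintegral_lintegral_swap (hgm.comp measurable_swap).aemeasurable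
  have h4 : ∫⁻ τ in Icc s t, ∫⁻ x, ‖commutator ρ a ψ R s t τ (X x (clamp s t τ))‖ₑ ≤
      ∫⁻ τ in Icc s t, Λ * ∫⁻ y, ‖commutator ρ a ψ R s t τ y‖ₑ := by
    refine setLIntegral_mono' measurableSet_Icc fun τ hτ => ?_
    rw [clamp_of_mem hτ]
    exact lintegral_comp_le_of_antilipschitz (hanti τ hτ) (hmono τ hτ).monotone.measurable
      (hcm.comp measurable_prodMk_left).enorm
  have hcl : Measurable fun τ => ∫⁻ y, ‖commutator ρ a ψ R s t τ y‖ₑ :=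
    hcm.enorm.lintegral_prod_right'
  rw [lintegral_const_mul _ hcl] at h4
  have hΛ' : (Λ : ENNReal) = ENNReal.ofReal (Real.exp (max E 0 / s * (t - s))) := by
    rw [ENNReal.ofReal_eq_coe_nnreal (Real.exp_pos _).le]
    rfl
  rw [hΛ'] at h4
  exact absurd ((h2.trans_eq h3).trans h4) (not_le.2 hsmall)

end TransportBV

/-! ### Nonnegativity of the mass and conclusion -/

namespace TransportBV

theorem integral_le_integral_abs_of_integrable {f : ℝ → ℝ} (hf : Integrable f) {x y : ℝ}
    (hxy : x ≤ y) : |∫ z in x..y, f z| ≤ ∫ z, |f z| := by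
  rw [intervalIntegral.integral_of_le hxy]
  refine abs_integral_le_integral_abs.trans ?_
  exact setIntegral_le_integral hf.abs (Eventually.of_forall fun _ => abs_nonneg _)

/-- A positive contribution can come only from the two end pieces outside `[l, r]`, each of length
at most `κ`. -/
theorem integral_le_of_nonpos_on_Icc {g : ℝ → ℝ} {x y l r κ C : ℝ} (hC : 0 ≤ C) (hκ : 0 ≤ κ)
    (hxy : x ≤ y) (hx : l - κ ≤ x) (hy : y ≤ r + κ) (hg : IntervalIntegrable g volume x y)
    (hgC : ∀ z ∈ Icc x y, g z ≤ C) (h0 : ∀ z ∈ Icc l r, g z ≤ 0) :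
    ∫ z in x..y, g z ≤ 2 * κ * C := by
  have hI : ∀ u v : ℝ, Integrable ((Icc u v).indicator fun _ => C) := fun u v =>
    (integrable_indicator_iff measurableSet_Icc).2 (integrableOn_const (by simp))
  have hn : ∀ u v z : ℝ, 0 ≤ (Icc u v).indicator (fun _ => C) z := fun u v z =>
    indicator_nonneg (fun _ _ => hC) z
  have hv : ∀ u : ℝ, ∫ z, (Icc u (u + κ)).indicator (fun _ => C) z = κ * C := fun u => by
    rw [integral_indicator measurableSet_Icc]
    simp [hκ]
  calc ∫ z in x..y, g z
      ≤ ∫ z in x..y, ((Icc (l - κ) (l - κ + κ)).indicator (fun _ => C) z +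
          (Icc r (r + κ)).indicator (fun _ => C) z) := by
        refine intervalIntegral.integral_mono_on hxy hg
          ((hI _ _).add (hI _ _)).intervalIntegrable fun z hz => ?_
        rcases le_or_gt z l with hzl | hzl
        · rw [indicator_of_mem (s := Icc (l - κ) (l - κ + κ)) ⟨hx.trans hz.1, by linarith⟩]
          linarith [hgC z hz, hn r (r + κ) z]
        · rcases le_or_gt r z with hzr | hzr
          · rw [indicator_of_mem (s := Icc r (r + κ)) ⟨hzr, hz.2.trans hy⟩]
            linarith [hgC z hz, hn (l - κ) (l - κ + κ) z]
          · exact (h0 z ⟨hzl.le, hzr.le⟩).trans (add_nonneg (hn _ _ _) (hn _ _ _))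
    _ ≤ ∫ z, ((Icc (l - κ) (l - κ + κ)).indicator (fun _ => C) z +
          (Icc r (r + κ)).indicator (fun _ => C) z) := by
        rw [intervalIntegral.integral_of_le hxy]
        exact setIntegral_le_integral ((hI _ _).add (hI _ _))
          (Eventually.of_forall fun z => add_nonneg (hn _ _ _) (hn _ _ _))
    _ = 2 * κ * C := by rw [integral_add (hI _ _) (hI _ _), hv, hv]; ring

variable {a ψ : ℝ → ℝ → ℝ}

/-- For `s` small, the mass of `ψ(·, s)` on intervals between two generalized characteristics
leaving from the end points of an interval where `ψ(·, 0) ≥ 0` is almost nonnegative. -/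
theorem IsBVSolution.exists_time_integral_ge (hψ : IsBVSolution a ψ) {ξ₀ ζ₀ : ℝ}
    (h_init : ∀ x ∈ Icc ξ₀ ζ₀, 0 ≤ ψ x 0) {ξ ζ : ℝ → ℝ} (hξ : IsForwardGenChar a ξ₀ ξ)
    (hζ : IsForwardGenChar a ζ₀ ζ) {R t η : ℝ} (hR : 0 ≤ R) (ht : 0 < t) (hη : 0 < η) :
    ∃ s, 0 < s ∧ s < t ∧ ∀ x y, x ≤ y → ξ s ≤ x → y ≤ ζ s → -R ≤ x → y ≤ R →
      -η ≤ ∫ z in x..y, ψ z s := by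
  obtain ⟨C, hC⟩ := hψ.normalizedBV.exists_bound le_rfl R
  have hC0 : 0 ≤ C := (abs_nonneg _).trans (hC 0 (by simpa using hR))
  -- By continuity of the curves, `[ξ s, ζ s]` exceeds `[ξ₀, ζ₀]` by less than `κ` on each side,
  -- costing at most `2 κ C ≤ η / 2`. The other `η / 2` pays for the `L¹` change of `ψ` from time
  -- `0` to `s`.
  set κ := η / (4 * (C + 1)) with hκ
  have hκ0 : 0 < κ := by positivity
  have hκC : 2 * κ * C ≤ η / 2 := by
    rw [hκ]
    have : 2 * (η / (4 * (C + 1))) * C = η / 2 * (C / (C + 1)) := by field_simp; ring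
    rw [this]
    exact mul_le_of_le_one_right (by positivity) ((div_le_one (by positivity)).2 (by linarith))
  have hnear : ∀ {y : ℝ → ℝ} {y₀ : ℝ}, IsForwardGenChar a y₀ y →
      ∀ᶠ s in 𝓝[>] (0 : ℝ), |y s - y₀| < κ := fun {y y₀} hy => by
    have h1 : Tendsto y (𝓝[>] 0) (𝓝 (y 0)) :=
      ((hy.continuousOn 0 self_mem_Ici).mono Ioi_subset_Ici_self).tendsto
    rw [hy.initial] at h1
    exact h1.eventually (Metric.ball_mem_nhds y₀ hκ0)
  have hcont : ∀ᶠ s in 𝓝[>] (0 : ℝ), ∫ x in (-R)..R, |ψ x s - ψ x 0| < η / 2 :=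
    ((hψ.continuousInTime R 0 hR le_rfl).mono_left
      (nhdsWithin_mono _ Ioi_subset_Ici_self)).eventually (gt_mem_nhds (by positivity))
  obtain ⟨s, h1, h2, h3, hs⟩ := ((hnear hξ).and ((hnear hζ).and
    (hcont.and (Ioo_mem_nhdsGT ht)))).exists
  refine ⟨s, hs.1, hs.2, fun x y hxy hξx hyζ hRx hyR => ?_⟩
  have hint : ∀ τ, 0 ≤ τ → ∀ l r, IntervalIntegrable (fun z => ψ z τ) volume l r := fun τ hτ l r =>
    hψ.normalizedBV.intervalIntegrable hτ l r
  have e1 : ∫ z in x..y, -ψ z 0 ≤ 2 * κ * C :=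
    integral_le_of_nonpos_on_Icc hC0 hκ0.le hxy (l := ξ₀) (r := ζ₀)
      (by linarith [(abs_lt.1 h1).1]) (by linarith [(abs_lt.1 h2).2]) (hint 0 le_rfl x y).neg
      (fun z hz => (neg_le_abs _).trans (hC z (abs_le.2 ⟨hRx.trans hz.1, hz.2.trans hyR⟩)))
      (fun z hz => neg_nonpos.2 (h_init z hz))
  have e2 : -(∫ z in (-R)..R, |ψ z s - ψ z 0|) ≤ ∫ z in x..y, (ψ z s - ψ z 0) := by
    have hd := (hint s hs.1.le (-R) R).sub (hint 0 le_rfl (-R) R)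
    have f1 : |∫ z in x..y, (ψ z s - ψ z 0)| ≤ ∫ z in x..y, |ψ z s - ψ z 0| :=
      intervalIntegral.abs_integral_le_integral_abs hxy
    have f2 : ∫ z in x..y, |ψ z s - ψ z 0| ≤ ∫ z in (-R)..R, |ψ z s - ψ z 0| :=
      intervalIntegral.integral_mono_interval hRx hxy hyR
        (Eventually.of_forall fun _ => abs_nonneg _) hd.abs
    linarith [neg_abs_le (∫ z in x..y, (ψ z s - ψ z 0))]
  rw [intervalIntegral.integral_sub (hint s hs.1.le x y) (hint 0 le_rfl x y)] at e2
  rw [intervalIntegral.integral_neg] at e1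
  linarith

/-- The mass at time `t` is compared with the mass at a small time `s` between two well-chosen
trajectories of the smoothed speed; all the errors together stay below the supposed deficit. -/
theorem IsBVSolution.integral_nonneg (ha : IsNormalizedBV a) (ha_bdd : IsLocallyBounded a)
    {E : ℝ} (hE : OleinikBound a E) (hψ : IsBVSolution a ψ) {ξ₀ ζ₀ : ℝ}
    (h_init : ∀ x ∈ Icc ξ₀ ζ₀, 0 ≤ ψ x 0) {ξ ζ : ℝ → ℝ} (hξ : IsForwardGenChar a ξ₀ ξ)
    (hζ : IsForwardGenChar a ζ₀ ζ) {t : ℝ} (ht : 0 < t) {x₁ x₂ : ℝ} (hx₁ : ξ t < x₁)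
    (hx : x₁ < x₂) (hx₂ : x₂ < ζ t) : 0 ≤ ∫ x in x₁..x₂, ψ x t := by
  by_contra! hneg
  -- The errors total `13 η`: `4 η` for each displaced end point, and `η` for each of the two
  -- commutators, the smoothing at `s`, the smoothing at `t` and the mass at `s`.
  obtain ⟨η, hη⟩ : ∃ η, ∫ x in x₁..x₂, ψ x t = -(16 * η) :=
    ⟨-(∫ x in x₁..x₂, ψ x t) / 16, by ring⟩
  have hη0 : 0 < η := by linarith
  have hbd : ∀ {y : ℝ → ℝ} {y₀ : ℝ}, IsForwardGenChar a y₀ y →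
      ∃ B, ∀ τ ∈ Icc 0 t, |y τ| ≤ B := fun {y y₀} hy =>
    isCompact_Icc.exists_bound_of_continuousOn (hy.continuousOn.mono fun τ hτ => hτ.1)
  obtain ⟨Bξ, hBξ⟩ := hbd hξ
  obtain ⟨Bζ, hBζ⟩ := hbd hζ
  -- The extra `1` leaves room for the kernel, whose width will be less than `1`.
  set R := max Bξ Bζ + 1 with hRdef
  have hξR : ∀ τ ∈ Icc 0 t, |ξ τ| + 1 ≤ R := fun τ hτ => by
    linarith [hBξ τ hτ, le_max_left Bξ Bζ]
  have hζR : ∀ τ ∈ Icc 0 t, |ζ τ| + 1 ≤ R := fun τ hτ => by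
    linarith [hBζ τ hτ, le_max_right Bξ Bζ]
  have hR : 0 ≤ R := by linarith [hξR t ⟨ht.le, le_rfl⟩, abs_nonneg (ξ t)]
  obtain ⟨C, hC⟩ := hψ.normalizedBV.exists_bound ht.le R
  have hC0 : 0 ≤ C := (abs_nonneg _).trans (hC 0 (by simpa using hR))
  -- `δ` keeps the displaced end points ordered, leaves half of the gap between `x₂` and `ζ t`, and
  -- makes the mass of an interval of length `δ` at most `4 η`.
  obtain ⟨δ, hδ0, hδ1, hδ2, hδ3⟩ : ∃ δ, 0 < δ ∧ x₁ + δ < x₂ ∧ x₂ + δ ≤ (x₂ + ζ t) / 2 ∧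
      C * δ ≤ 4 * η := by
    refine ⟨min (min ((x₂ - x₁) / 2) ((ζ t - x₂) / 2)) (4 * η / (C + 1)), ?_, ?_, ?_, ?_⟩
    · refine lt_min (lt_min (by linarith) (by linarith)) (by positivity)
    · linarith [(min_le_left (min ((x₂ - x₁) / 2) ((ζ t - x₂) / 2)) (4 * η / (C + 1))).trans
        (min_le_left _ _)]
    · linarith [(min_le_left (min ((x₂ - x₁) / 2) ((ζ t - x₂) / 2)) (4 * η / (C + 1))).trans
        (min_le_right _ _)]
    · calc C * min (min ((x₂ - x₁) / 2) ((ζ t - x₂) / 2)) (4 * η / (C + 1))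
          ≤ (C + 1) * (4 * η / (C + 1)) := by
            refine mul_le_mul (by linarith) (min_le_right _ _) ?_ (by positivity)
            exact le_min (le_min (by linarith) (by linarith)) (by positivity)
        _ = 4 * η := by field_simp
  -- `s` is chosen before the kernel, so that `Λ` below is a fixed constant while `ε n → 0`.
  obtain ⟨s, hs, hst', hmass⟩ := hψ.exists_time_integral_ge h_init hξ hζ hR ht hη0
  have hst := hst'.le
  obtain ⟨ρ, ε, hρ, hε⟩ := exists_isRightKernel_seq
  set Λ := Real.exp (max E 0 / s * (t - s)) with hΛ
  have hεΛ : Tendsto (fun n => ε n * Λ) atTop (𝓝 0) := by simpa using hε.mul_const Λ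
  have hI : Tendsto (fun n => ENNReal.ofReal Λ * ∫⁻ τ in Icc s t, ∫⁻ y,
      ‖commutator (ρ n) a ψ R s t τ y‖ₑ) atTop (𝓝 0) := by
    simpa using ENNReal.Tendsto.const_mul
      (tendsto_lintegral_commutator hρ hε ha ha_bdd hψ hR hs.le hst)
      (Or.inr (ENNReal.ofReal_ne_top (r := Λ)))
  have hpos : 0 < ENNReal.ofReal η * ENNReal.ofReal δ := by
    rw [← ENNReal.ofReal_mul hη0.le, ENNReal.ofReal_pos]
    positivity
  have hEs := tendsto_integral_abs_avg_localDensity_sub hρ hε hψ.normalizedBV hs.le hst R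
  obtain ⟨n, hn1, hn2, hn3, hn4, hn5, hn6⟩ := ((hε.eventually (gt_mem_nhds one_pos)).and
    ((hεΛ.eventually (gt_mem_nhds (sub_pos.2 hx₁))).and
    ((hεΛ.eventually (gt_mem_nhds (half_pos (sub_pos.2 hx₂)))).and
    (((hEs s).eventually (gt_mem_nhds hη0)).and
    (((hEs t).eventually (gt_mem_nhds hη0)).and
    (hI.eventually (gt_mem_nhds hpos))))))).exists
  have h := hρ n
  choose X hX hXt using exists_trajectory h ha ha_bdd hR hs.le hst
  obtain ⟨y₁, hy₁, hc₁⟩ := exists_small_commutator h ha ha_bdd hE hψ.normalizedBV hR hs hst hX hXt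
    x₁ hn6
  obtain ⟨y₂, hy₂, hc₂⟩ := exists_small_commutator h ha ha_bdd hE hψ.normalizedBV hR hs hst hX hXt
    x₂ hn6
  have hIcc : ∀ τ ∈ Icc s t, τ ∈ Icc 0 t := fun τ hτ => ⟨hs.le.trans hτ.1, hτ.2⟩
  have hleft : ∀ τ ∈ Icc s t, ξ τ < X y₁ τ := fun τ hτ =>
    hξ.lt_trajectory h ha ha_bdd hE hR hs hst (hX y₁)
      (fun σ hσ => by linarith [hξR σ (hIcc σ hσ)]) (by rw [hXt]; linarith [hy₁.1]) hτ
  have hXR : ∀ τ ∈ Icc s t, -R ≤ X y₁ τ := fun τ hτ => by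
    linarith [hleft τ hτ, hξR τ (hIcc τ hτ), neg_abs_le (ξ τ)]
  have hXY : ∀ τ ∈ Icc s t, X y₁ τ ≤ X y₂ τ := fun τ hτ => by
    have hlt : X y₁ t < X y₂ t := by rw [hXt, hXt]; linarith [hy₁.2, hy₂.1]
    have h1 := (hX y₁).sub_le_mul_exp h ha ha_bdd hE hR hs hst (hX y₂) hlt hτ
    by_contra! hn
    have := mul_nonpos_of_nonpos_of_nonneg (sub_nonpos.2 hn.le) (Real.exp_pos
      (max E 0 / s * (t - s))).le
    linarith
  have hright : ∀ τ ∈ Icc s t, X y₂ τ < ζ τ := fun τ hτ =>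
    hζ.trajectory_lt h ha ha_bdd hE hR hs hst (hX y₂)
      (fun σ hσ => by linarith [hζR σ (hIcc σ hσ)])
      (fun σ hσ => (hXR σ hσ).trans (hXY σ hσ)) (by rw [hXt]; linarith [hy₂.2]) hτ
  have hYR : ∀ τ ∈ Icc s t, X y₂ τ + ε n ≤ R := fun τ hτ => by
    linarith [hright τ hτ, hζR τ (hIcc τ hτ), le_abs_self (ζ τ)]
  have hmain := integral_avg_localDensity_trajectory h ha ha_bdd hψ hR hs hst (hX y₁) (hX y₂)
    hXY hXR hYR
  have hcmp : ∀ τ ∈ Icc s t, |(∫ y in (X y₁ τ)..(X y₂ τ), avg (ρ n) (localDensity ψ R s t τ) y) -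
      ∫ y in (X y₁ τ)..(X y₂ τ), ψ y τ| ≤
      ∫ y, |avg (ρ n) (localDensity ψ R s t τ) y - localDensity ψ R s t τ y| := fun τ hτ => by
    have hp := integrable_localDensity hψ.normalizedBV hs.le hst R τ
    have hav := (h.integrable_avg hp).1
    have he : ∫ y in (X y₁ τ)..(X y₂ τ), ψ y τ =
        ∫ y in (X y₁ τ)..(X y₂ τ), localDensity ψ R s t τ y := by
      refine intervalIntegral.integral_congr fun y hy => ?_
      rw [uIcc_of_le (hXY τ hτ)] at hy
      exact (localDensity_eq ⟨(hXR τ hτ).trans hy.1,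
        by linarith [hy.2, hYR τ hτ, h.nonneg_width]⟩ hτ).symm
    rw [he, ← intervalIntegral.integral_sub hav.intervalIntegrable hp.intervalIntegrable]
    exact integral_le_integral_abs_of_integrable (hav.sub hp) (hXY τ hτ)
  have hs_mem : s ∈ Icc s t := ⟨le_rfl, hst⟩
  have ht_mem : t ∈ Icc s t := ⟨hst, le_rfl⟩
  have g1 := abs_le.1 (hcmp s hs_mem)
  have g2 := abs_le.1 (hcmp t ht_mem)
  have g3 := hmass _ _ (hXY s hs_mem) (hleft s hs_mem).le (hright s hs_mem).le (hXR s hs_mem)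
    (by linarith [hYR s hs_mem, h.nonneg_width])
  rw [hXt, hXt] at g2 hmain
  have hint : ∀ l r, IntervalIntegrable (fun z => ψ z t) volume l r := fun l r =>
    hψ.normalizedBV.intervalIntegrable ht.le l r
  have hshort : ∀ x y, -R ≤ x → y ≤ R → x ≤ y → y ≤ x + δ → |∫ z in x..y, ψ z t| ≤ 4 * η :=
    fun x y hRx hyR hxy hyx => by
      rw [← Real.norm_eq_abs]
      refine (intervalIntegral.norm_integral_le_of_norm_le_const (C := C) fun z hz => ?_).trans ?_
      · rw [uIoc_of_le hxy] at hz
        exact hC z (abs_le.2 ⟨hRx.trans hz.1.le, hz.2.trans hyR⟩)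
      · rw [abs_of_nonneg (sub_nonneg.2 hxy)]
        exact (mul_le_mul_of_nonneg_left (by linarith) hC0).trans hδ3
  have ht0 : t ∈ Icc 0 t := ⟨ht.le, le_rfl⟩
  have hl := hξR t ht0
  have hr := hζR t ht0
  have hl' := neg_abs_le (ξ t)
  have hr' := le_abs_self (ζ t)
  have g4 := abs_le.1 (hshort x₁ y₁ (by linarith) (by linarith [hy₁.2]) hy₁.1 hy₁.2)
  have g5 := abs_le.1 (hshort x₂ y₂ (by linarith) (by linarith [hy₂.2]) hy₂.1 hy₂.2)
  have g6 := intervalIntegral.integral_add_adjacent_intervals (hint x₁ y₁) (hint y₁ y₂)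
  have g7 := intervalIntegral.integral_add_adjacent_intervals (hint x₁ x₂) (hint x₂ y₂)
  have c1 := abs_le.1 hc₁
  have c2 := abs_le.1 hc₂
  linarith

/-- If `f x < 0`, right-continuity keeps `f` below `f x / 2` just to the right of `x`, making short
integrals starting at `x` negative. -/
theorem nonneg_of_integral_nonneg {f : ℝ → ℝ} {x z : ℝ} (hxz : x < z)
    (hf : ContinuousWithinAt f (Ici x) x) (hint : ∀ l r, IntervalIntegrable f volume l r)
    (h : ∀ y ∈ Ioo x z, 0 ≤ ∫ w in x..y, f w) : 0 ≤ f x := by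
  by_contra! hneg
  have hev : ∀ᶠ w in 𝓝[≥] x, f w < f x / 2 := hf.eventually (gt_mem_nhds (by linarith))
  obtain ⟨u, hu, hu'⟩ := (mem_nhdsGE_iff_exists_Icc_subset).1 hev
  obtain ⟨y, hxy, hy⟩ := exists_between (lt_min (show x < u from hu) hxz)
  have h1 : ∫ w in x..y, f w ≤ ∫ _ in x..y, f x / 2 :=
    intervalIntegral.integral_mono_on hxy.le (hint x y) intervalIntegrable_const fun w hw =>
      le_of_lt (hu' ⟨hw.1, hw.2.trans (hy.le.trans (min_le_left _ _))⟩)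
  rw [intervalIntegral.integral_const, smul_eq_mul] at h1
  have h2 := h y ⟨hxy, hy.trans_le (min_le_right _ _)⟩
  nlinarith [mul_pos (sub_pos.2 hxy) (neg_pos.2 hneg)]

end TransportBV

theorem theorem4p5 (a ψ : ℝ → ℝ → ℝ)
    (ha : TransportBV.IsNormalizedBV a) (ha_bdd : TransportBV.IsLocallyBounded a)
    (hE : ∃ E : ℝ, TransportBV.OleinikBound a E)
    (hψ : TransportBV.IsBVSolution a ψ)
    (ξ₀ ζ₀ : ℝ) (hξζ : ξ₀ ≤ ζ₀)
    (h_init : ∀ x ∈ Icc ξ₀ ζ₀, 0 ≤ ψ x 0)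
    (ξ ζ : ℝ → ℝ)
    (hξ : TransportBV.IsForwardGenChar a ξ₀ ξ) (hζ : TransportBV.IsForwardGenChar a ζ₀ ζ) :
    ∀ t : ℝ, 0 ≤ t → ∀ x ∈ Ioo (ξ t) (ζ t), 0 ≤ ψ x t := by
  obtain ⟨E, hE⟩ := hE
  intro t ht x hx
  -- At `t = 0` the curves are at their starting points and the claim is the hypothesis on the
  -- initial value; the one-sided bound is available only for positive times.
  rcases ht.eq_or_lt with rfl | ht'
  · rw [hξ.initial, hζ.initial] at hx
    exact h_init x (Ioo_subset_Icc_self hx)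
  · exact TransportBV.nonneg_of_integral_nonneg (f := fun x => ψ x t) hx.2
      (hψ.normalizedBV.rightContinuous t ht x)
      (hψ.normalizedBV.intervalIntegrable ht)
      fun y hy => hψ.integral_nonneg ha ha_bdd hE h_init hξ hζ ht' hx.1 hy.1 hy.2
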